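/- Let $E,A\in\mathbb{R}^{n\times n}$ and $B\in\mathbb{R}^{n\times m}$, where $E$ is invertible and all eigenvalues of $E^{-1}A$ have negative real part. Let $\sigma_1,\dots,\sigma_k\in\mathbb{C}$ be shifts with $\operatorname{Re}\sigma_i>0$ such that every $z\in\mathbb{C}$ occurs among them exactly as often as $\bar z$ (the shifts need not be distinct). Let $Z=[Z_1,\dots,Z_k]\in\mathbb{C}^{n\times km}$ be the ADI basis $$Z_1=\sqrt{2\operatorname{Re}\sigma_1}\,(A-\sigma_1E)^{-1}B,\qquad Z_i=\sqrt{\tfrac{\operatorname{Re}\sigma_i}{\operatorname{Re}\sigma_{i-1}}}\,\bigl(I+(\sigma_i+\bar\sigma_{i-1})(A-\sigma_iE)^{-1}E\bigr)Z_{i-1}\quad(2\le i\le k).$$ Let $\mathcal K\subseteq\mathbb{C}^n$ be the rational block Krylov subspace spanned by the columns of all matrices $\bigl((A-\sigma_iE)^{-1}E\bigr)^{j}(A-\sigma_iE)^{-1}B$ with $1\le i\le k$ and $0\le j<\mu_i$, where $\mu_i$ is the number of times that $\sigma_i$ occurs among the shifts (for distinct shifts, this is the span of the columns of $(A-\sigma_iE)^{-1}B$,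 $1\le i\le k$). Put $q=km$, and let $V\in\mathbb{R}^{n\times q}$ be a matrix whose columns form a basis of $\mathcal K$ (so $\dim\mathcal K=km$). Let $W\in\mathbb{R}^{n\times q}$, $A_q=W^TAV$, $E_q=W^TEV$, $B_q=W^TB$, with $E_q$ invertible, and let $P_q\in\mathbb{R}^{q\times q}$ satisfy $$A_qP_qE_q^T+E_qP_qA_q^T+B_qB_q^T=0\qquad\text{and}\qquad VP_qV^T=ZZ^*.$$ Let $C\in\mathbb{R}^{p\times n}$ be arbitrary, $C_q=CV$, $G(s)=C(sE-A)^{-1}B$ and $G_q(s)=C_q(sE_q-A_q)^{-1}B_q$. Let $\mathcal T$ be the set of all systems $\tilde G(s)=\tilde C(s\tilde E-\tilde A)^{-1}\tilde B$ with real matrices $\tilde E,\tilde A\in\mathbb{R}^{q\times q}$, $\tilde E$ invertible, such that $\tilde E^{-1}\tilde A$ and $E_q^{-1}A_q$ have the same Jordan canonical form, and with arbitrary $\tilde B\in\mathbb{R}^{q\times m}$, $\tilde C\in\mathbb{R}^{p\times q}$. Then $G_q\in\mathcal T$, the error $G-\tilde G$ has finite $\mathcal H_2$ norm for every $\tilde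 G\in\mathcal T$, and $$\|G-G_q\|_{\mathcal H_2}=\min_{\tilde G\in\mathcal T}\|G-\tilde G\|_{\mathcal H_2},\qquad\text{where}\quad \|H\|_{\mathcal H_2}^2=\frac1{2\pi}\int_{-\infty}^{\infty}\operatorname{trace}\bigl(\overline{H(\mathrm{j}\omega)}\,H(\mathrm{j}\omega)^T\bigr)\,d\omega .$$ -/

import Mathlib

open scoped Matrix ComplexConjugate

/-- A real matrix, viewed as a complex one. -/
noncomputable abbrev toC {a b : Type*} (M : Matrix a b ℝ) : Matrix a b ℂ :=
  M.map (fun x : ℝ => (x : ℂ))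

/-- `E x' = A x + B u` is asymptotically stable: the eigenvalues of `E⁻¹ A` lie in the open left
half-plane (used together with the invertibility of `E`). -/
def AsymptoticallyStable {n : ℕ} (E A : Matrix (Fin n) (Fin n) ℝ) : Prop :=
  ∀ μ ∈ spectrum ℂ (toC (E⁻¹ * A)), μ.re < 0

/-- The transfer function `s ↦ C (s E - A)⁻¹ B`. -/
noncomputable def transferFunction {n m p : ℕ} (E A : Matrix (Fin n) (Fin n) ℝ)
    (B : Matrix (Fin n) (Fin m) ℝ) (C : Matrix (Fin p) (Fin n) ℝ) :
    ℂ → Matrix (Fin p) (Fin m) ℂ :=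
  fun s => toC C * (s • toC E - toC A)⁻¹ * toC B

/-- The function `ω ↦ trace (conj (G (j ω)) * (G (j ω))ᵀ)`. -/
noncomputable def h2Integrand {p m : ℕ} (G : ℂ → Matrix (Fin p) (Fin m) ℂ) : ℝ → ℂ :=
  fun ω => ((G (Complex.I * ω)).map conj * (G (Complex.I * ω))ᵀ).trace

/-- `G` has a finite `H₂` norm: the integral that defines the norm converges. -/
def HasFiniteH2Norm {p m : ℕ} (G : ℂ → Matrix (Fin p) (Fin m) ℂ) : Prop :=
  MeasureTheory.Integrable (h2Integrand G)

/-- The `H₂` norm (meaningful when `HasFiniteH2Norm G`). The integrand is real and nonnegative. -/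
noncomputable def h2Norm {p m : ℕ} (G : ℂ → Matrix (Fin p) (Fin m) ℂ) : ℝ :=
  Real.sqrt (1 / (2 * Real.pi) * ∫ ω : ℝ, (h2Integrand G ω).re)

/-- The blocks `Z₁, Z₂, …` of the low-rank ADI iteration with shifts `σ` (indexed from `0`). -/
noncomputable def adiBlock {n m k : ℕ} (E A : Matrix (Fin n) (Fin n) ℝ)
    (B : Matrix (Fin n) (Fin m) ℝ) (σ : Fin k → ℂ) :
    (i : ℕ) → i < k → Matrix (Fin n) (Fin m) ℂ
  | 0, h => (Real.sqrt (2 * (σ ⟨0, h⟩).re) : ℂ) • ((toC A - σ ⟨0, h⟩ • toC E)⁻¹ * toC B)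
  | i + 1, h =>
      (Real.sqrt ((σ ⟨i + 1, h⟩).re / (σ ⟨i, Nat.lt_of_succ_lt h⟩).re) : ℂ) •
        ((1 + (σ ⟨i + 1, h⟩ + conj (σ ⟨i, Nat.lt_of_succ_lt h⟩)) •
            ((toC A - σ ⟨i + 1, h⟩ • toC E)⁻¹ * toC E)) *
          adiBlock E A B σ i (Nat.lt_of_succ_lt h))

/-- The ADI basis `Z = [Z₁, …, Z_k]`; column `(i, j)` is the `j`-th column of the `i`-th block. -/
noncomputable def adiBasis {n m k : ℕ} (E A : Matrix (Fin n) (Fin n) ℝ)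
    (B : Matrix (Fin n) (Fin m) ℝ) (σ : Fin k → ℂ) : Matrix (Fin n) (Fin k × Fin m) ℂ :=
  Matrix.of fun r c => adiBlock E A B σ c.1 c.1.isLt r c.2

/-- The number of times that `z` occurs among the shifts. -/
noncomputable def shiftMult {k : ℕ} (σ : Fin k → ℂ) (z : ℂ) : ℕ :=
  Set.ncard {i | σ i = z}

/-- The rational input block Krylov subspace: the span of the columns of
`((A - σᵢ E)⁻¹ E) ^ j (A - σᵢ E)⁻¹ B`, where `j` is less than the multiplicity of the shift `σᵢ`.
If the shifts are distinct, only `j = 0` occurs, and this is the span of the columns of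
`(A - σ₁ E)⁻¹ B, …, (A - σ_k E)⁻¹ B`. -/
noncomputable def krylovSubspace {n m k : ℕ} (E A : Matrix (Fin n) (Fin n) ℝ)
    (B : Matrix (Fin n) (Fin m) ℝ) (σ : Fin k → ℂ) : Submodule ℂ (Fin n → ℂ) :=
  Submodule.span ℂ {v | ∃ (i : Fin k) (j : ℕ) (c : Fin m), j < shiftMult σ (σ i) ∧
    v = ((((toC A - σ i • toC E)⁻¹ * toC E) ^ j) * ((toC A - σ i • toC E)⁻¹ * toC B)).col c}

/-- The columns of the real matrix `V` form a basis of the rational block Krylov subspace. -/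
def IsRealKrylovBasis {n m k q : ℕ} (E A : Matrix (Fin n) (Fin n) ℝ)
    (B : Matrix (Fin n) (Fin m) ℝ) (σ : Fin k → ℂ) (V : Matrix (Fin n) (Fin q) ℝ) : Prop :=
  LinearIndependent ℂ (toC V).col ∧
    Submodule.span ℂ (Set.range (toC V).col) = krylovSubspace E A B σ

/-- The Jordan block of size `d` with eigenvalue `μ`. -/
def jordanBlock (μ : ℂ) (d : ℕ) : Matrix (Fin d) (Fin d) ℂ :=
  Matrix.of fun i j => if i = j then μ else if (i : ℕ) + 1 = j then 1 else 0

/-- The block diagonal matrix with Jordan blocks `jordanBlock (μ i) (d i)` is a Jordan canonical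
form of `M`: with an invertible matrix `P` (whose inverse is `Q`), `M = P J P⁻¹`. -/
def HasJordanForm {q r : ℕ} (M : Matrix (Fin q) (Fin q) ℂ) (μ : Fin r → ℂ) (d : Fin r → ℕ) :
    Prop :=
  (∀ i, 0 < d i) ∧
    ∃ (P : Matrix (Fin q) (Σ i, Fin (d i)) ℂ) (Q : Matrix (Σ i, Fin (d i)) (Fin q) ℂ),
      P * Q = 1 ∧ Q * P = 1 ∧
        M = P * Matrix.blockDiagonal' (fun i => jordanBlock (μ i) (d i)) * Q

/-- `M` and `N` share the same Jordan canonical form. -/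
def SameJordanForm {q : ℕ} (M N : Matrix (Fin q) (Fin q) ℂ) : Prop :=
  ∃ (r : ℕ) (μ : Fin r → ℂ) (d : Fin r → ℕ), HasJordanForm M μ d ∧ HasJordanForm N μ d

/-- The systems `C' (s E' - A')⁻¹ B'` of order `q` with `p` outputs and `m` inputs for which
`E'⁻¹ A'` and `E⁻¹ A` share the same Jordan canonical form, with `B'` and `C'` arbitrary. -/
def sameJordanSystems {q : ℕ} (p m : ℕ) (E A : Matrix (Fin q) (Fin q) ℝ) :
    Set (ℂ → Matrix (Fin p) (Fin m) ℂ) :=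
  {H | ∃ (E' A' : Matrix (Fin q) (Fin q) ℝ) (B' : Matrix (Fin q) (Fin m) ℝ)
      (C' : Matrix (Fin p) (Fin q) ℝ), IsUnit E'.det ∧
        SameJordanForm (toC (E'⁻¹ * A')) (toC (E⁻¹ * A)) ∧ H = transferFunction E' A' B' C'}

/-!
With `M = E⁻¹ A` and `b = E⁻¹ B`, the ADI blocks are `Zᵢ = √(2 Re σᵢ) (M - σᵢ)⁻¹ wᵢ`, where the
residual factors satisfy `wᵢ₊₁ = wᵢ + √(2 Re σᵢ) Zᵢ`. Hence the basis satisfies a Sylvester equation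
`M Z = Z S + b L` with lossless coefficients, `S + Sᴴ = Lᴴ L` (`isLosslessBasis_adiMatrix`). Its
columns span the Krylov space by a partial fraction argument (`krylovSubspace_le_range`), so
`V = Z T` with `T` invertible.

In the coordinates of `Z`, the reduced Gramian is the identity, and the Lyapunov equation of the
projected system says that a positive semidefinite square vanishes. This identifies the projected
system with `(-Sᴴ, -Lᴴ, C Z)` (`IsLosslessBasis.projection_eq`); its poles are the mirror images of
the shifts and it is stable. Sharing the Jordan form means similarity, so every competing system has
the form `c (z + Sᴴ)⁻¹ β` with `c`, `β` complex (`exists_realization_of_mem_sameJordanSystems`).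

Such a system is orthogonal to the error `G - G_q`. Indeed `S` is a Kronecker product `s ⊗ I` with
an observable `s`, so there is a `Y` commuting with `S` with `L Y = -βᴴ` (`exists_commute_adiS`).
With this `Y`, the integrand of the inner product is on the imaginary axis the trace of
`C (z - M)⁻¹ (Z Sᴴ + M Z) (z + Sᴴ)⁻¹ Y cᴴ` (`IsLosslessBasis.error_mul_conjTranspose`), which is
holomorphic in the right half-plane and `O (1 / z ^ 2)`. Its integral is zero by Cauchy's theorem
(`HardyDecay.integral_mul_eq_zero`), and the Pythagorean theorem gives the minimum.

That `G_q` belongs to the class requires a Jordan form of `E_q⁻¹ A_q` to exist; this is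
`exists_hasJordanForm`, a consequence of the structure theorem for modules over `ℂ[X]`.
-/

/-! ### Functions that are holomorphic and decay in the closed right half-plane -/

/-- `f` is holomorphic near every point of the closed right half-plane and is `O (1 / (1 + ‖z‖))`
there. Entries of stable, strictly proper transfer functions have this property, and it is stable
under linear combinations. -/
def HardyDecay (f : ℂ → ℂ) : Prop :=
  (∀ z : ℂ, 0 ≤ z.re → DifferentiableAt ℂ f z) ∧
    ∃ c : ℝ, ∀ z : ℂ, 0 ≤ z.re → ‖f z‖ * (1 + ‖z‖) ≤ c

namespace HardyDecay

variable {f g : ℂ → ℂ}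

theorem zero : HardyDecay (fun _ => 0) :=
  ⟨fun _ _ => differentiableAt_const _, 0, fun z _ => by simp⟩

theorem add (hf : HardyDecay f) (hg : HardyDecay g) : HardyDecay (fun z => f z + g z) := by
  obtain ⟨hf, c, hc⟩ := hf
  obtain ⟨hg, d, hd⟩ := hg
  refine ⟨fun z hz => (hf z hz).add (hg z hz), c + d, fun z hz => ?_⟩
  calc ‖f z + g z‖ * (1 + ‖z‖) ≤ (‖f z‖ + ‖g z‖) * (1 + ‖z‖) := by
        gcongr; exact norm_add_le _ _
    _ ≤ c + d := by rw [add_mul]; exact add_le_add (hc z hz) (hd z hz)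

theorem const_mul (a : ℂ) (hf : HardyDecay f) : HardyDecay (fun z => a * f z) := by
  obtain ⟨hf, c, hc⟩ := hf
  refine ⟨fun z hz => (hf z hz).const_mul a, ‖a‖ * c, fun z hz => ?_⟩
  rw [norm_mul, mul_assoc]
  exact mul_le_mul_of_nonneg_left (hc z hz) (norm_nonneg _)

theorem mul_const (a : ℂ) (hf : HardyDecay f) : HardyDecay (fun z => f z * a) := by
  simpa only [mul_comm] using hf.const_mul a

theorem sub (hf : HardyDecay f) (hg : HardyDecay g) : HardyDecay (fun z => f z - g z) := by
  simpa [sub_eq_add_neg] using hf.add (hg.const_mul (-1))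

theorem sum {ι : Type*} (s : Finset ι) {f : ι → ℂ → ℂ} (h : ∀ i ∈ s, HardyDecay (f i)) :
    HardyDecay (fun z => ∑ i ∈ s, f i z) := by
  classical
  induction s using Finset.induction_on with
  | empty => simpa using zero
  | insert a s ha ih =>
    simp only [Finset.sum_insert ha]
    exact (h a (Finset.mem_insert_self _ _)).add
      (ih fun i hi => h i (Finset.mem_insert_of_mem hi))

theorem continuous_imaginaryAxis (hf : HardyDecay f) :
    Continuous fun ω : ℝ => f (Complex.I * ω) := by
  refine continuous_iff_continuousAt.2 fun ω => ?_
  have h : ContinuousAt f (Complex.I * ω) := (hf.1 _ (by simp)).continuousAt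
  exact ContinuousAt.comp (f := fun ω : ℝ => Complex.I * (ω : ℂ)) h (by fun_prop)

/-- The square-integrability is stated with the product of two functions in mind, for which it
gives integrability on the imaginary axis. -/
theorem memLp_imaginaryAxis (hf : HardyDecay f) :
    MeasureTheory.MemLp (fun ω : ℝ => f (Complex.I * ω)) 2 := by
  refine (MeasureTheory.memLp_two_iff_integrable_sq_norm
    hf.continuous_imaginaryAxis.aestronglyMeasurable).2 ?_
  obtain ⟨c, hc⟩ := hf.2
  refine (integrable_inv_one_add_sq.const_mul (c ^ 2)).mono'
    (hf.continuous_imaginaryAxis.norm.pow 2).aestronglyMeasurable (.of_forall fun ω => ?_)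
  have h := hc (Complex.I * ω) (by simp)
  simp only [norm_mul, Complex.norm_I, one_mul, Complex.norm_real, Real.norm_eq_abs] at h
  rw [Real.norm_of_nonneg (by positivity), ← div_eq_mul_inv, le_div_iff₀ (by positivity)]
  have h0 : 0 ≤ ‖f (Complex.I * ω)‖ := norm_nonneg _
  calc ‖f (Complex.I * ω)‖ ^ 2 * (1 + ω ^ 2)
      ≤ ‖f (Complex.I * ω)‖ ^ 2 * (1 + |ω|) ^ 2 := by
        gcongr; rw [← sq_abs ω]; nlinarith [abs_nonneg ω]
    _ = (‖f (Complex.I * ω)‖ * (1 + |ω|)) ^ 2 := by ring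
    _ ≤ c ^ 2 := by gcongr

/-- The Cauchy integral theorem on the right half-plane: the rectangles `[0, T] × [-T, T]` have
three sides on which the product is `O (1 / T ^ 2)`. -/
theorem integral_mul_eq_zero (hf : HardyDecay f) (hg : HardyDecay g) :
    ∫ ω : ℝ, f (Complex.I * ω) * g (Complex.I * ω) = 0 := by
  have hint : MeasureTheory.Integrable fun ω : ℝ => f (Complex.I * ω) * g (Complex.I * ω) :=
    hf.memLp_imaginaryAxis.integrable_mul hg.memLp_imaginaryAxis
  obtain ⟨hf, c, hc⟩ := hf
  obtain ⟨hg, d, hd⟩ := hg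
  set F : ℂ → ℂ := fun z => f z * g z with hF
  have hbd : ∀ T : ℝ, 0 < T → ∀ z : ℂ, 0 ≤ z.re → T ≤ ‖z‖ → ‖F z‖ ≤ c * d / T ^ 2 := by
    intro T hT z hz hTz
    have h1 : ‖f z‖ * T ≤ c :=
      (mul_le_mul_of_nonneg_left (by linarith) (norm_nonneg _)).trans (hc z hz)
    have h2 : ‖g z‖ * T ≤ d :=
      (mul_le_mul_of_nonneg_left (by linarith) (norm_nonneg _)).trans (hd z hz)
    rw [le_div_iff₀ (by positivity), hF, norm_mul]
    calc ‖f z‖ * ‖g z‖ * T ^ 2 = (‖f z‖ * T) * (‖g z‖ * T) := by ring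
      _ ≤ c * d := mul_le_mul h1 h2 (by positivity) (le_trans (by positivity) h1)
  have hle : ∀ T : ℝ, 0 < T →
      ‖∫ ω : ℝ in (-T)..T, F (Complex.I * ω)‖ ≤ 4 * (c * d) / T := by
    intro T hT
    have key := Complex.integral_boundary_rect_eq_zero_of_differentiableOn F
      (⟨0, -T⟩ : ℂ) (⟨T, T⟩ : ℂ) (fun z hz => by
        have hz1 := hz.1
        simp only [Set.mem_preimage, Set.uIcc_of_le hT.le] at hz1
        exact ((hf z hz1.1).mul (hg z hz1.1)).differentiableWithinAt)
    simp only [smul_eq_mul, Complex.ofReal_zero, zero_add] at key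
    have e1 : ‖∫ x : ℝ in (0 : ℝ)..T, F (x + ((-T : ℝ) : ℂ) * Complex.I)‖ ≤
        c * d / T ^ 2 * |T - 0| := by
      refine intervalIntegral.norm_integral_le_of_norm_le_const fun x hx => ?_
      rw [Set.uIoc_of_le hT.le] at hx
      refine hbd T hT _ (by simpa using hx.1.le) ?_
      calc T = |((x : ℂ) + ((-T : ℝ) : ℂ) * Complex.I).im| := by simp [abs_of_pos hT]
        _ ≤ _ := Complex.abs_im_le_norm _
    have e2 : ‖∫ x : ℝ in (0 : ℝ)..T, F (x + (T : ℂ) * Complex.I)‖ ≤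
        c * d / T ^ 2 * |T - 0| := by
      refine intervalIntegral.norm_integral_le_of_norm_le_const fun x hx => ?_
      rw [Set.uIoc_of_le hT.le] at hx
      refine hbd T hT _ (by simpa using hx.1.le) ?_
      calc T = |((x : ℂ) + (T : ℂ) * Complex.I).im| := by simp [abs_of_pos hT]
        _ ≤ _ := Complex.abs_im_le_norm _
    have e3 : ‖∫ y : ℝ in (-T)..T, F ((T : ℂ) + y * Complex.I)‖ ≤
        c * d / T ^ 2 * |T - -T| := by
      refine intervalIntegral.norm_integral_le_of_norm_le_const fun x hx => ?_
      refine hbd T hT _ (by simpa using hT.le) ?_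
      calc T = |((T : ℂ) + x * Complex.I).re| := by simp [abs_of_pos hT]
        _ ≤ _ := Complex.abs_re_le_norm _
    have e4 : ‖∫ ω : ℝ in (-T)..T, F (Complex.I * ω)‖ =
        ‖(∫ x : ℝ in (0 : ℝ)..T, F (x + ((-T : ℝ) : ℂ) * Complex.I)) -
          (∫ x : ℝ in (0 : ℝ)..T, F (x + (T : ℂ) * Complex.I)) +
          Complex.I * (∫ y : ℝ in (-T)..T, F ((T : ℂ) + y * Complex.I))‖ := by
      rw [sub_eq_zero.1 key, norm_mul, Complex.norm_I, one_mul]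
      simp only [mul_comm Complex.I]
    rw [e4]
    refine (norm_add_le _ _).trans ((add_le_add_left (norm_sub_le _ _) _).trans ?_)
    rw [norm_mul, Complex.norm_I, one_mul]
    refine (add_le_add (add_le_add e1 e2) e3).trans (le_of_eq ?_)
    rw [sub_zero, sub_neg_eq_add, abs_of_pos hT, abs_of_pos (by linarith)]
    field_simp
    ring
  have hlim := MeasureTheory.intervalIntegral_tendsto_integral hint
    Filter.tendsto_neg_atTop_atBot Filter.tendsto_id
  refine tendsto_nhds_unique hlim ?_
  refine squeeze_zero_norm' (a := fun T : ℝ => 4 * (c * d) / T) ?_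
    (tendsto_const_nhds.div_atTop Filter.tendsto_id)
  filter_upwards [Filter.eventually_gt_atTop 0] with T hT using hle T hT

end HardyDecay

/-- The eigenvalues of `M` lie in the open left half-plane. -/
def IsHurwitz {ι : Type*} [Fintype ι] [DecidableEq ι] (M : Matrix ι ι ℂ) : Prop :=
  ∀ z ∈ spectrum ℂ M, z.re < 0

namespace IsHurwitz

variable {ι : Type*} [Fintype ι] [DecidableEq ι] {M : Matrix ι ι ℂ}

theorem isUnit (hM : IsHurwitz M) {z : ℂ} (hz : 0 ≤ z.re) :
    IsUnit (z • (1 : Matrix ι ι ℂ) - M) := by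
  by_contra h
  have : z ∈ spectrum ℂ M := by
    rw [spectrum.mem_iff, Algebra.algebraMap_eq_smul_one]; exact h
  exact absurd (hM z this) (not_lt.2 hz)

attribute [local instance] Matrix.linftyOpNormedRing Matrix.linftyOpNormedAlgebra in
theorem hardyDecay_resolvent (hM : IsHurwitz M) (i j : ι) :
    HardyDecay fun z => (z • (1 : Matrix ι ι ℂ) - M)⁻¹ i j := by
  have hres : ∀ z : ℂ, (z • (1 : Matrix ι ι ℂ) - M)⁻¹ = resolvent M z := fun z => by
    rw [Matrix.nonsing_inv_eq_ringInverse, resolvent, Algebra.algebraMap_eq_smul_one]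
  have hset : ∀ z : ℂ, 0 ≤ z.re → z ∈ resolventSet ℂ M := fun z hz => by
    rw [spectrum.mem_resolventSet_iff, Algebra.algebraMap_eq_smul_one]; exact hM.isUnit hz
  have hdiff : ∀ z : ℂ, 0 ≤ z.re → DifferentiableAt ℂ (resolvent M) z := fun z hz =>
    (spectrum.hasDerivAt_resolvent_const_left (hset z hz)).differentiableAt
  let e : Matrix ι ι ℂ →ₗ[ℂ] ℂ := Matrix.entryLinearMap ℂ ℂ i j
  have he : Continuous e := LinearMap.continuous_of_finiteDimensional e
  let e' : Matrix ι ι ℂ →L[ℂ] ℂ := ⟨e, he⟩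
  have hfun : (fun z => (z • (1 : Matrix ι ι ℂ) - M)⁻¹ i j) = fun z : ℂ => e' (resolvent M z) := by
    funext z; rw [hres]; rfl
  rw [hfun]
  refine ⟨fun z hz => e'.differentiableAt.comp z (hdiff z hz), ?_⟩
  have hnorm : ∀ X : Matrix ι ι ℂ, ‖e' X‖ ≤ ‖X‖ := fun X => by
    rw [Matrix.linfty_opNorm_def, ← coe_nnnorm, NNReal.coe_le_coe]
    exact (Finset.single_le_sum (f := fun j => ‖X i j‖₊) (fun _ _ => zero_le)
      (Finset.mem_univ j)).trans (Finset.le_sup (f := fun i => ∑ j, ‖X i j‖₊) (Finset.mem_univ i))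
  obtain ⟨a, ha⟩ := (spectrum.resolvent_isBigO_inv (𝕜 := ℂ) M).bound
  obtain ⟨R, -, hR⟩ := (Filter.hasBasis_cobounded_norm (E := ℂ)).eventually_iff.1 ha
  have hK : IsCompact (Metric.closedBall (0 : ℂ) (max R 1) ∩ {z : ℂ | 0 ≤ z.re}) :=
    (isCompact_closedBall _ _).inter_right (isClosed_le continuous_const Complex.continuous_re)
  have hcont : ContinuousOn (fun z => ‖e' (resolvent M z)‖ * (1 + ‖z‖))
      (Metric.closedBall (0 : ℂ) (max R 1) ∩ {z : ℂ | 0 ≤ z.re}) := by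
    intro z hz
    exact (((e'.continuous.continuousAt.comp (hdiff z hz.2).continuousAt).norm).mul
      (by fun_prop)).continuousWithinAt
  obtain ⟨b, hb⟩ := (hK.image_of_continuousOn hcont).bddAbove
  refine ⟨max b (a * 2), fun z hz => ?_⟩
  by_cases hzR : ‖z‖ ≤ max R 1
  · exact le_max_of_le_left (hb ⟨z, ⟨by simpa using hzR, hz⟩, rfl⟩)
  · push Not at hzR
    refine le_max_of_le_right ?_
    have h1 : 1 < ‖z‖ := (le_max_right _ _).trans_lt hzR
    have h2 := hR (show z ∈ _ from ((le_max_left R 1).trans hzR.le))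
    rw [norm_inv] at h2
    have ha0 : 0 ≤ a := by
      have := (norm_nonneg _).trans h2
      have hz0 : 0 < ‖z‖⁻¹ := by positivity
      nlinarith
    calc ‖e' (resolvent M z)‖ * (1 + ‖z‖) ≤ (a * ‖z‖⁻¹) * (‖z‖ + ‖z‖) := by
          gcongr
          exact (hnorm _).trans h2
      _ = a * 2 := by field_simp; ring

theorem hardyDecay_mul_resolvent_mul {α β : Type*} (hM : IsHurwitz M) (X : Matrix α ι ℂ)
    (Y : Matrix ι β ℂ) (i : α) (j : β) :
    HardyDecay fun z => (X * (z • (1 : Matrix ι ι ℂ) - M)⁻¹ * Y) i j := by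
  simp only [Matrix.mul_apply]
  exact .sum _ fun l _ => .mul_const _ (.sum _ fun l' _ =>
    .const_mul _ (hM.hardyDecay_resolvent l' l))

end IsHurwitz

/-! ### Existence of the Jordan canonical form -/

section JordanForm

open Polynomial

/-- In `ℂ[X] ⧸ ((X - μ) ^ e)` the classes of `(X - μ) ^ (e - 1 - j)`, `j < e`, form a basis, a Jordan
chain for the multiplication by `X`. -/
theorem exists_basis_quotient_X_sub_C_pow (μ : ℂ) (e : ℕ) :
    ∃ b : Module.Basis (Fin e) ℂ (ℂ[X] ⧸ Ideal.span {(X - C μ : ℂ[X]) ^ e}),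
      ∀ j, b j = Ideal.Quotient.mk _ ((X - C μ) ^ (e - 1 - j)) := by
  have hmonic : ((X - C μ : ℂ[X]) ^ e).Monic := (monic_X_sub_C μ).pow e
  have hfin : Module.finrank ℂ (ℂ[X] ⧸ Ideal.span {(X - C μ : ℂ[X]) ^ e}) = e := by
    rw [finrank_quotient_span_eq_natDegree]; simp
  let v : Fin e → ℂ[X] ⧸ Ideal.span {(X - C μ : ℂ[X]) ^ e} :=
    fun j => Ideal.Quotient.mk _ ((X - C μ) ^ (e - 1 - j))
  have hspan : ⊤ ≤ Submodule.span ℂ (Set.range v) := by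
    rintro x -
    obtain ⟨f, rfl⟩ := Ideal.Quotient.mk_surjective x
    rw [← sum_taylor_eq f μ, Polynomial.sum, map_sum]
    refine Submodule.sum_mem _ fun i _ => ?_
    rw [← smul_eq_C_mul]
    have hsm : Ideal.Quotient.mk (Ideal.span {(X - C μ : ℂ[X]) ^ e})
        ((taylor μ f).coeff i • (X - C μ) ^ i) =
        (taylor μ f).coeff i • Ideal.Quotient.mk (Ideal.span {(X - C μ : ℂ[X]) ^ e})
          ((X - C μ) ^ i) := rfl
    rw [hsm]
    refine Submodule.smul_mem _ _ ?_
    by_cases hi : i < e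
    · refine Submodule.subset_span ⟨⟨e - 1 - i, by omega⟩, ?_⟩
      simp only [v]
      congr 2
      omega
    · have : Ideal.Quotient.mk (Ideal.span {(X - C μ : ℂ[X]) ^ e}) ((X - C μ) ^ i) = 0 := by
        rw [Ideal.Quotient.eq_zero_iff_mem, Ideal.mem_span_singleton]
        exact pow_dvd_pow _ (not_lt.1 hi)
      rw [this]
      exact Submodule.zero_mem _
  have : Module.Finite ℂ (ℂ[X] ⧸ Ideal.span {(X - C μ : ℂ[X]) ^ e}) :=
    ⟨(Submodule.fg_def).2 ⟨Set.range v, Set.finite_range v, le_antisymm le_top hspan⟩⟩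
  exact ⟨basisOfTopLeSpanOfCardEqFinrank v hspan (by simp [hfin]), fun j => by
    rw [coe_basisOfTopLeSpanOfCardEqFinrank]⟩

/-- Every endomorphism of a finite-dimensional complex vector space has a basis of Jordan chains: the
structure theorem for the torsion module over `ℂ[X]` that it defines. -/
theorem exists_jordan_basis {U : Type*} [AddCommGroup U] [Module ℂ U] [FiniteDimensional ℂ U]
    (φ : Module.End ℂ U) :
    ∃ (ι : Type) (_ : Fintype ι) (μ : ι → ℂ) (e : ι → ℕ)
      (b : Module.Basis (Σ i, Fin (e i)) ℂ U), ∀ i (j : Fin (e i)),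
        φ (b ⟨i, j⟩) = μ i • b ⟨i, j⟩ +
          if 0 < (j : ℕ) then b ⟨i, ⟨j - 1, (Nat.sub_le _ _).trans_lt j.2⟩⟩ else 0 := by
  classical
  obtain ⟨ι, hι, p, hp, e, ⟨Φ⟩⟩ := Module.equiv_directSum_of_isTorsion
    (Module.AEval.isTorsion_of_finiteDimensional ℂ U φ)
  have hroot : ∀ i, ∃ μ : ℂ, Ideal.span {p i ^ e i} = Ideal.span {(X - C μ : ℂ[X]) ^ e i} := by
    intro i
    obtain ⟨μ, hμ⟩ := exists_root_of_degree_eq_one (IsAlgClosed.degree_eq_one_of_irreducible ℂ (hp i))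
    refine ⟨μ, Ideal.span_singleton_eq_span_singleton.2 (Associated.pow_pow ?_)⟩
    exact ((irreducible_X_sub_C μ).associated_of_dvd (hp i) (dvd_iff_isRoot.2 hμ)).symm
  choose μ hμ using hroot
  choose b hb using fun i => exists_basis_quotient_X_sub_C_pow (μ i) (e i)
  let Ψ : ∀ i, (ℂ[X] ⧸ Ideal.span {(X - C (μ i) : ℂ[X]) ^ e i}) ≃ₗ[ℂ[X]]
      (ℂ[X] ⧸ Ideal.span {p i ^ e i}) := fun i => Submodule.quotEquivOfEq _ _ (hμ i).symm
  let b' : ∀ i, Module.Basis (Fin (e i)) ℂ (ℂ[X] ⧸ Ideal.span {p i ^ e i}) :=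
    fun i => (b i).map ((Ψ i).restrictScalars ℂ)
  let B : Module.Basis (Σ i, Fin (e i)) ℂ (DirectSum ι fun i => ℂ[X] ⧸ Ideal.span {p i ^ e i}) :=
    DFinsupp.basis b'
  have hB : ∀ i j, B ⟨i, j⟩ = DirectSum.lof ℂ[X] ι (fun i => ℂ[X] ⧸ Ideal.span {p i ^ e i}) i
      (Ψ i (Ideal.Quotient.mk _ ((X - C (μ i)) ^ (e i - 1 - j)))) := by
    intro i j
    rw [← hb i j]
    refine Module.Basis.apply_eq_iff.2 ?_
    ext ⟨i', j'⟩
    change (b' i').repr ((DFinsupp.single i (Ψ i (b i j)) : Π₀ i, ℂ[X] ⧸ Ideal.span {p i ^ e i}) i')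
      j' = _
    have hb' : Ψ i (b i j) = b' i j := by simp [b']
    rw [hb']
    by_cases h : i = i'
    · subst h
      simp [Finsupp.single_apply]
    · rw [DFinsupp.single_eq_of_ne (Ne.symm h), Finsupp.single_eq_of_ne (by
        rintro ⟨⟩; exact h rfl), map_zero, Finsupp.zero_apply]
  have hX : ∀ i (j : Fin (e i)), (X : ℂ[X]) • B ⟨i, j⟩ = μ i • B ⟨i, j⟩ +
      if 0 < (j : ℕ) then B ⟨i, ⟨j - 1, (Nat.sub_le _ _).trans_lt j.2⟩⟩ else 0 := by
    intro i j
    have hsm : μ i • B ⟨i, j⟩ = (C (μ i) : ℂ[X]) • B ⟨i, j⟩ := by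
      rw [← algebraMap_smul ℂ[X] (μ i) (B ⟨i, j⟩)]; rfl
    rw [← add_sub_cancel (C (μ i)) X, add_smul, hsm]
    congr 1
    rw [hB, ← map_smul, ← map_smul]
    have hm : (X - C (μ i)) • Ideal.Quotient.mk (Ideal.span {(X - C (μ i) : ℂ[X]) ^ e i})
        ((X - C (μ i)) ^ (e i - 1 - j)) = Ideal.Quotient.mk _ ((X - C (μ i)) ^ (e i - j)) := by
      have : e i - j = (e i - 1 - j) + 1 := by have := j.2; omega
      rw [this, pow_succ']; rfl
    rw [hm]
    split_ifs with hj
    · rw [hB]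
      have : e i - j = e i - 1 - (j - 1) := by have := j.2; omega
      simp only [this]
    · have : Ideal.Quotient.mk (Ideal.span {(X - C (μ i) : ℂ[X]) ^ e i})
          ((X - C (μ i)) ^ (e i - j)) = 0 := by
        rw [Ideal.Quotient.eq_zero_iff_mem, Ideal.mem_span_singleton]
        exact pow_dvd_pow _ (by omega)
      rw [this, map_zero, map_zero]
  let Θ : (DirectSum ι fun i => ℂ[X] ⧸ Ideal.span {p i ^ e i}) ≃ₗ[ℂ] U :=
    (Φ.symm.restrictScalars ℂ).trans (Module.AEval'.of φ).symm
  have hΘ : ∀ x, Θ ((X : ℂ[X]) • x) = φ (Θ x) := by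
    intro x
    change (Module.AEval'.of φ).symm (Φ.symm (X • x)) = φ ((Module.AEval'.of φ).symm (Φ.symm x))
    rw [map_smul, Module.AEval'.of_symm_X_smul]
  refine ⟨ι, hι, μ, e, B.map Θ, fun i j => ?_⟩
  simp only [Module.Basis.map_apply]
  rw [← hΘ, hX, map_add, map_smul]
  split_ifs
  · rfl
  · rw [map_zero]

/-- Every complex matrix has a Jordan canonical form. -/
theorem exists_hasJordanForm {q : ℕ} (M : Matrix (Fin q) (Fin q) ℂ) :
    ∃ (r : ℕ) (μ : Fin r → ℂ) (d : Fin r → ℕ), HasJordanForm M μ d := by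
  classical
  obtain ⟨ι, hι, μ, e, b, hb⟩ := exists_jordan_basis (Matrix.toLin' M)
  -- The indices of empty chains are dropped, as Jordan blocks have positive size.
  let f : Fin (Fintype.card {i // 0 < e i}) → ι := fun i => ((Fintype.equivFin {i // 0 < e i}).symm i).1
  have hfinj : Function.Injective f :=
    Subtype.val_injective.comp (Fintype.equivFin {i // 0 < e i}).symm.injective
  let σ : (Σ i, Fin (e (f i))) → Σ i, Fin (e i) := fun x => ⟨f x.1, x.2⟩
  have hσ : Function.Bijective σ := by
    constructor
    · rintro ⟨i, j⟩ ⟨i', j'⟩ h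
      obtain rfl : i = i' := hfinj (congrArg Sigma.fst h)
      simpa [σ] using h
    · rintro ⟨i, j⟩
      refine ⟨⟨Fintype.equivFin {i // 0 < e i} ⟨i, j.pos⟩, j.cast (by simp [f])⟩, ?_⟩
      have : f (Fintype.equivFin {i // 0 < e i} ⟨i, j.pos⟩) = i := by simp [f]
      refine Sigma.ext this ?_
      simp only [σ]
      refine (Fin.heq_ext_iff (by rw [this])).2 ?_
      simp
  let c : Module.Basis (Σ i, Fin (e (f i))) ℂ (Fin q → ℂ) := b.reindex (Equiv.ofBijective σ hσ).symm
  have hc : ∀ i (j : Fin (e (f i))), M *ᵥ c ⟨i, j⟩ = μ (f i) • c ⟨i, j⟩ +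
      if 0 < (j : ℕ) then c ⟨i, ⟨j - 1, (Nat.sub_le _ _).trans_lt j.2⟩⟩ else 0 := by
    intro i j
    have := hb (f i) j
    simp only [Matrix.toLin'_apply] at this
    simpa [c, σ] using this
  refine ⟨_, fun i => μ (f i), fun i => e (f i),
    fun i => ((Fintype.equivFin {i // 0 < e i}).symm i).2,
    (Pi.basisFun ℂ (Fin q)).toMatrix c, c.toMatrix (Pi.basisFun ℂ (Fin q)),
    Module.Basis.toMatrix_mul_toMatrix_flip _ _, Module.Basis.toMatrix_mul_toMatrix_flip _ _, ?_⟩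
  have hMP : M * (Pi.basisFun ℂ (Fin q)).toMatrix c = (Pi.basisFun ℂ (Fin q)).toMatrix c *
      Matrix.blockDiagonal' (fun i => jordanBlock (μ (f i)) (e (f i))) := by
    ext a ⟨i, j⟩
    have h1 := congrFun (hc i j) a
    simp only [Matrix.mulVec, dotProduct, Pi.add_apply, Pi.smul_apply, smul_eq_mul] at h1
    simp only [Matrix.mul_apply, Module.Basis.toMatrix_apply, Pi.basisFun_repr]
    rw [h1, Fintype.sum_sigma, Finset.sum_eq_single i]
    · simp only [Matrix.blockDiagonal'_apply_eq, jordanBlock, Matrix.of_apply]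
      rw [← Finset.add_sum_erase _ _ (Finset.mem_univ j), if_pos rfl, mul_comm]
      congr 1
      split_ifs with hj
      · rw [Finset.sum_eq_single ⟨j - 1, (Nat.sub_le _ _).trans_lt j.2⟩]
        · rw [if_neg (by rw [Fin.ext_iff]; simp only; omega),
            if_pos (by simp only; omega), mul_one]
        · intro j' hj' hne
          rw [if_neg (Finset.ne_of_mem_erase hj'), if_neg, mul_zero]
          intro h
          exact hne (Fin.ext (by simp only; omega))
        · intro h
          exact absurd (Finset.mem_erase.2 ⟨by rw [ne_eq, Fin.ext_iff]; simp only; omega,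
            Finset.mem_univ _⟩) h
      · refine (Finset.sum_eq_zero fun j' hj' => ?_).symm
        rw [if_neg (Finset.ne_of_mem_erase hj'), if_neg (by omega), mul_zero]
    · intro i' _ hne
      refine Finset.sum_eq_zero fun j' _ => ?_
      rw [Matrix.blockDiagonal'_apply_ne _ _ _ hne, mul_zero]
    · intro h; exact absurd (Finset.mem_univ _) h
  rw [← hMP, Matrix.mul_assoc, Module.Basis.toMatrix_mul_toMatrix_flip, Matrix.mul_one]

end JordanForm

/-! ### The ADI iteration in normalized form -/

section ADI

variable {ι κ : Type*} [Fintype ι] [DecidableEq ι]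

/-- The residual factors of the ADI iteration for the pair `(M, b)`: each step multiplies by the
Cayley transform `(M + conj σ) (M - σ)⁻¹`. The shifts form an infinite sequence. -/
noncomputable def adiResidual (M : Matrix ι ι ℂ) (b : Matrix ι κ ℂ) (σ : ℕ → ℂ) : ℕ → Matrix ι κ ℂ
  | 0 => b
  | i + 1 => (M + conj (σ i) • (1 : Matrix ι ι ℂ)) * ((M - σ i • (1 : Matrix ι ι ℂ))⁻¹ *
      adiResidual M b σ i)

/-- The scaling factor `√(2 Re σᵢ)` of the `i`-th ADI block. -/
noncomputable def adiWeight (σ : ℕ → ℂ) (i : ℕ) : ℝ := Real.sqrt (2 * (σ i).re)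

/-- The ADI blocks for the pair `(M, b)`, expressed by the residual factors. -/
noncomputable def adiSeq (M : Matrix ι ι ℂ) (b : Matrix ι κ ℂ) (σ : ℕ → ℂ) (i : ℕ) :
    Matrix ι κ ℂ :=
  (adiWeight σ i : ℂ) • ((M - σ i • (1 : Matrix ι ι ℂ))⁻¹ * adiResidual M b σ i)

variable {M : Matrix ι ι ℂ} {b : Matrix ι κ ℂ} {σ : ℕ → ℂ}

theorem IsHurwitz.isUnit_det_sub_smul (hM : IsHurwitz M) {z : ℂ} (hz : 0 < z.re) :
    IsUnit (M - z • (1 : Matrix ι ι ℂ)).det := by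
  rw [← Matrix.isUnit_iff_isUnit_det, ← neg_sub]
  exact (hM.isUnit hz.le).neg

theorem adiWeight_mul_self {i : ℕ} (hσ : 0 < (σ i).re) :
    (adiWeight σ i : ℂ) * adiWeight σ i = σ i + conj (σ i) := by
  rw [← Complex.ofReal_mul, adiWeight, Real.mul_self_sqrt (by linarith), Complex.add_conj]

theorem adiWeight_ne_zero {i : ℕ} (hσ : 0 < (σ i).re) : (adiWeight σ i : ℂ) ≠ 0 := by
  rw [Complex.ofReal_ne_zero, adiWeight]
  exact (Real.sqrt_pos.2 (by linarith)).ne'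

theorem mul_adiSeq (hM : IsHurwitz M) {i : ℕ} (hσ : 0 < (σ i).re) :
    M * adiSeq M b σ i = σ i • adiSeq M b σ i + (adiWeight σ i : ℂ) • adiResidual M b σ i := by
  have h : (M - σ i • (1 : Matrix ι ι ℂ)) * adiSeq M b σ i =
      (adiWeight σ i : ℂ) • adiResidual M b σ i := by
    rw [adiSeq, Matrix.mul_smul, Matrix.mul_nonsing_inv_cancel_left _ _ (hM.isUnit_det_sub_smul hσ)]
  rw [← h, Matrix.sub_mul, Matrix.smul_mul, Matrix.one_mul, add_sub_cancel]

theorem adiResidual_succ (hM : IsHurwitz M) {i : ℕ} (hσ : 0 < (σ i).re) :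
    adiResidual M b σ (i + 1) = adiResidual M b σ i + (adiWeight σ i : ℂ) • adiSeq M b σ i := by
  rw [adiSeq, smul_smul, adiWeight_mul_self hσ]
  conv_lhs => rw [adiResidual]
  have : M + conj (σ i) • (1 : Matrix ι ι ℂ) =
      (M - σ i • (1 : Matrix ι ι ℂ)) + (σ i + conj (σ i)) • (1 : Matrix ι ι ℂ) := by
    rw [add_smul]; abel
  rw [this, Matrix.add_mul, Matrix.mul_nonsing_inv_cancel_left _ _ (hM.isUnit_det_sub_smul hσ),
    Matrix.smul_mul, Matrix.one_mul]

theorem adiResidual_eq_sum (hM : IsHurwitz M) (hσ : ∀ i, 0 < (σ i).re) (i : ℕ) :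
    adiResidual M b σ i = b + ∑ j ∈ Finset.range i, (adiWeight σ j : ℂ) • adiSeq M b σ j := by
  induction i with
  | zero => simp [adiResidual]
  | succ i ih => rw [adiResidual_succ hM (hσ i), ih, Finset.sum_range_succ, add_assoc]

/-- The recursion that defines the ADI blocks holds for `adiSeq`. -/
theorem adiSeq_succ (hM : IsHurwitz M) (hσ : ∀ i, 0 < (σ i).re) (i : ℕ) :
    adiSeq M b σ (i + 1) = (Real.sqrt ((σ (i + 1)).re / (σ i).re) : ℂ) •
      ((1 + (σ (i + 1) + conj (σ i)) • (M - σ (i + 1) • (1 : Matrix ι ι ℂ))⁻¹) *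
        adiSeq M b σ i) := by
  have h1 : (1 : Matrix ι ι ℂ) + (σ (i + 1) + conj (σ i)) • (M - σ (i + 1) • (1 : Matrix ι ι ℂ))⁻¹ =
      (M - σ (i + 1) • (1 : Matrix ι ι ℂ))⁻¹ * (M + conj (σ i) • (1 : Matrix ι ι ℂ)) := by
    have : M + conj (σ i) • (1 : Matrix ι ι ℂ) = (M - σ (i + 1) • (1 : Matrix ι ι ℂ)) +
        (σ (i + 1) + conj (σ i)) • (1 : Matrix ι ι ℂ) := by
      rw [add_smul]; abel
    rw [this, Matrix.mul_add, Matrix.nonsing_inv_mul _ (hM.isUnit_det_sub_smul (hσ _)),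
      Matrix.mul_smul, Matrix.mul_one]
  have h2 : (adiWeight σ (i + 1) : ℂ) =
      (Real.sqrt ((σ (i + 1)).re / (σ i).re) : ℂ) * adiWeight σ i := by
    rw [← Complex.ofReal_mul, adiWeight, adiWeight,
      ← Real.sqrt_mul (div_nonneg (hσ _).le (hσ _).le)]
    congr 2
    have := (hσ i).ne'
    field_simp
  rw [h1, adiSeq, adiSeq, adiResidual, Matrix.mul_smul, smul_smul, ← h2, Matrix.mul_assoc]

open Polynomial in
/-- The partial fraction argument for the ADI basis: modulo the factor `∏ (M - σⱼ)`, the first `i`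
blocks span `p(M) b` for all polynomials `p` of degree less than `i`. -/
theorem exists_sum_adiSeq (hM : IsHurwitz M) (hσ : ∀ i, 0 < (σ i).re) (i : ℕ) (p : ℂ[X])
    (hp : p.degree < i) :
    ∃ a : ℕ → ℂ, aeval M (∏ j ∈ Finset.range i, (X - C (σ j))) *
      ∑ j ∈ Finset.range i, a j • adiSeq M b σ j = aeval M p * b := by
  set Q : ℕ → ℂ[X] := fun i => ∏ j ∈ Finset.range i, (X - C (σ j)) with hQ
  set N : ℕ → ℂ[X] := fun i => ∏ j ∈ Finset.range i, (X + C (conj (σ j))) with hN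
  have hX : ∀ z : ℂ, aeval M (X - C z) = M - z • (1 : Matrix ι ι ℂ) := fun z => by
    simp [Algebra.algebraMap_eq_smul_one]
  have hX' : ∀ z : ℂ, aeval M (X + C z) = M + z • (1 : Matrix ι ι ℂ) := fun z => by
    simp [Algebra.algebraMap_eq_smul_one]
  have hres : ∀ i, aeval M (Q i) * adiResidual M b σ i = aeval M (N i) * b := by
    intro i
    induction i with
    | zero => simp [hQ, hN, adiResidual]
    | succ i ih =>
      have e1 : Q (i + 1) = Q i * (X - C (σ i)) := Finset.prod_range_succ _ _
      have e2 : N (i + 1) = (X + C (conj (σ i))) * N i := by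
        rw [mul_comm]; exact Finset.prod_range_succ _ _
      rw [adiResidual, ← hX', ← Matrix.mul_assoc, ← map_mul, e1,
        show Q i * (X - C (σ i)) * (X + C (conj (σ i))) =
          (X + C (conj (σ i))) * Q i * (X - C (σ i)) by ring, map_mul, map_mul, hX,
        Matrix.mul_assoc, Matrix.mul_nonsing_inv_cancel_left _ _ (hM.isUnit_det_sub_smul (hσ i)),
        Matrix.mul_assoc, ih, ← Matrix.mul_assoc, ← map_mul, e2]
  induction i generalizing p with
  | zero =>
    have : p = 0 := by simpa using hp
    exact ⟨0, by simp [this]⟩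
  | succ i ih =>
    have e1 : Q (i + 1) = Q i * (X - C (σ i)) := Finset.prod_range_succ _ _
    have hNe : (N i).eval (σ i) ≠ 0 := by
      rw [hN, eval_prod, Finset.prod_ne_zero_iff]
      intro j _ h0
      have := congrArg Complex.re h0
      simp at this
      linarith [hσ i, hσ j]
    have hNd : (N i).degree < (i + 1 : ℕ) := by
      have : (N i).degree = i := by
        rw [hN, degree_prod]; simp
      rw [this]
      exact_mod_cast Nat.lt_succ_self i
    obtain ⟨p', hp'⟩ := dvd_iff_isRoot.2
      (show (p - C (p.eval (σ i) / (N i).eval (σ i)) * N i).IsRoot (σ i) by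
        simp [hNe])
    have hdeg : p'.degree < i := by
      have h1 : (p - C (p.eval (σ i) / (N i).eval (σ i)) * N i).degree < (i + 1 : ℕ) :=
        (degree_sub_le _ _).trans_lt (max_lt hp ((by
          rw [← smul_eq_C_mul]; exact degree_smul_le _ _ : degree _ ≤ (N i).degree).trans_lt hNd))
      rw [hp', degree_mul, degree_X_sub_C] at h1
      by_cases h0 : p' = 0
      · simp [h0]
      · rw [degree_eq_natDegree h0] at h1 ⊢
        norm_cast at h1 ⊢
        omega
    obtain ⟨a, ha⟩ := ih p' hdeg
    refine ⟨fun j => if j = i then p.eval (σ i) / (N i).eval (σ i) * (adiWeight σ i : ℂ)⁻¹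
      else a j, ?_⟩
    have hZ : aeval M (Q (i + 1)) * adiSeq M b σ i = (adiWeight σ i : ℂ) • (aeval M (N i) * b) := by
      rw [e1, map_mul, hX, adiSeq, Matrix.mul_smul, Matrix.mul_assoc,
        Matrix.mul_nonsing_inv_cancel_left _ _ (hM.isUnit_det_sub_smul (hσ i)), hres]
    have hs : ∑ j ∈ Finset.range i, (if j = i then
        p.eval (σ i) / (N i).eval (σ i) * (adiWeight σ i : ℂ)⁻¹ else a j) • adiSeq M b σ j =
        ∑ j ∈ Finset.range i, a j • adiSeq M b σ j :=
      Finset.sum_congr rfl fun j hj => by rw [if_neg (Finset.mem_range.1 hj).ne]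
    have hQ' : ∏ j ∈ Finset.range (i + 1), (X - C (σ j)) = Q (i + 1) := rfl
    rw [show ∏ j ∈ Finset.range i, (X - C (σ j)) = Q i from rfl] at ha
    rw [hQ', Finset.sum_range_succ]
    beta_reduce
    rw [if_pos rfl, hs, Matrix.mul_add, Matrix.mul_smul, hZ, smul_smul,
      inv_mul_cancel_right₀ (adiWeight_ne_zero (hσ i)), e1, mul_comm (Q i), map_mul,
      Matrix.mul_assoc, ha, ← Matrix.mul_assoc, ← map_mul, ← hp', map_sub, Matrix.sub_mul, map_mul,
      aeval_C, Algebra.algebraMap_eq_smul_one, smul_mul_assoc, one_mul, Matrix.smul_mul,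
      sub_add_cancel]

open Polynomial in
/-- The ADI blocks span the rational Krylov blocks: `(M - z)⁻ʲ b` with `j` up to the multiplicity of
`z` as a shift. -/
theorem exists_resolvent_pow_mul_eq_sum_adiSeq (hM : IsHurwitz M) (hσ : ∀ i, 0 < (σ i).re)
    {k j : ℕ} {z : ℂ} (hz : 0 < z.re) (hj : j < ((Finset.range k).filter (σ · = z)).card) :
    ∃ a : ℕ → ℂ, (M - z • (1 : Matrix ι ι ℂ))⁻¹ ^ (j + 1) * b =
      ∑ i ∈ Finset.range k, a i • adiSeq M b σ i := by
  set r := ((Finset.range k).filter (σ · = z)).card with hr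
  set R : ℂ[X] := ∏ i ∈ (Finset.range k).filter (¬ σ · = z), (X - C (σ i))
  have hQ : ∏ i ∈ Finset.range k, (X - C (σ i)) = (X - C z) ^ (j + 1) * ((X - C z) ^ (r - (j + 1)) * R) := by
    rw [← Finset.prod_filter_mul_prod_filter_not _ (σ · = z), ← mul_assoc, ← pow_add,
      Nat.add_sub_cancel' hj]
    congr 1
    rw [hr, ← Finset.prod_const]
    exact Finset.prod_congr rfl fun i hi => by rw [(Finset.mem_filter.1 hi).2]
  have hdeg : ((X - C z) ^ (r - (j + 1)) * R).degree < (k : WithBot ℕ) := by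
    have h1 : ((∏ i ∈ Finset.range k, (X - C (σ i))) : ℂ[X]).degree = k := by
      rw [degree_prod]; simp
    have hne : (X - C z) ^ (r - (j + 1)) * R ≠ 0 := by
      intro h
      rw [hQ, h, mul_zero, degree_zero] at h1
      simp at h1
    rw [hQ, degree_mul, degree_pow, degree_X_sub_C, degree_eq_natDegree hne] at h1
    rw [degree_eq_natDegree hne]
    simp only [nsmul_eq_mul, mul_one] at h1
    norm_cast at h1 ⊢
    omega
  obtain ⟨a, ha⟩ := exists_sum_adiSeq (b := b) hM hσ k _ hdeg
  have hX : ∀ z : ℂ, aeval M (X - C z) = M - z • (1 : Matrix ι ι ℂ) := fun z => by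
    simp [Algebra.algebraMap_eq_smul_one]
  have hunit : IsUnit (aeval M (∏ i ∈ Finset.range k, (X - C (σ i)))).det := by
    rw [← Matrix.isUnit_iff_isUnit_det]
    induction Finset.range k using Finset.induction_on with
    | empty => simp
    | insert i s hi ih =>
      rw [Finset.prod_insert hi, map_mul, hX]
      exact ((Matrix.isUnit_iff_isUnit_det _).2 (hM.isUnit_det_sub_smul (hσ i))).mul ih
  have hz' := hM.isUnit_det_sub_smul hz
  have hcancel : (M - z • (1 : Matrix ι ι ℂ)) ^ (j + 1) *
      (M - z • (1 : Matrix ι ι ℂ))⁻¹ ^ (j + 1) = 1 := by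
    rw [← Commute.mul_pow, Matrix.mul_nonsing_inv _ hz', one_pow]
    exact (Matrix.mul_nonsing_inv _ hz').trans (Matrix.nonsing_inv_mul _ hz').symm
  refine ⟨a, ?_⟩
  rw [← Matrix.nonsing_inv_mul_cancel_left _ (∑ i ∈ Finset.range k, a i • adiSeq M b σ i) hunit,
    ha, ← Matrix.nonsing_inv_mul_cancel_left _ (_ * b) hunit]
  congr 1
  rw [hQ, mul_comm, map_mul (aeval M) _ ((X - C z) ^ (j + 1)), map_pow _ (X - C z) (j + 1), hX,
    Matrix.mul_assoc (aeval M _), ← Matrix.mul_assoc (_ ^ _), hcancel, Matrix.one_mul]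

end ADI

/-! ### Krylov bases with a lossless Sylvester equation -/

/-- The columns of `Z` are linearly independent and satisfy the Sylvester equation
`M Z = Z S + b L` of a rational Krylov basis, whose coefficients are lossless: `S + Sᴴ = Lᴴ L`. -/
structure IsLosslessBasis {ι κ μ : Type*} [Fintype ι] [DecidableEq ι] [Fintype κ] [Fintype μ]
    (M : Matrix ι ι ℂ) (b : Matrix ι μ ℂ) (S : Matrix κ κ ℂ) (L : Matrix μ κ ℂ)
    (Z : Matrix ι κ ℂ) : Prop where
  hurwitz : IsHurwitz M
  sylvester : M * Z = Z * S + b * L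
  lossless : S + Sᴴ = Lᴴ * L
  injective : ∀ v, Z *ᵥ v = 0 → v = 0

namespace IsLosslessBasis

open scoped ComplexOrder

variable {ι κ μ : Type*} [Fintype ι] [DecidableEq ι] [Fintype κ] [Fintype μ]
  {M : Matrix ι ι ℂ} {b : Matrix ι μ ℂ} {S : Matrix κ κ ℂ} {L : Matrix μ κ ℂ} {Z : Matrix ι κ ℂ}

theorem two_re_mul_normSq (h : IsLosslessBasis M b S L Z) {v : κ → ℂ} {z : ℂ}
    (hv : S *ᵥ v = z • v) : (z + conj z) * (star v ⬝ᵥ v) = star (L *ᵥ v) ⬝ᵥ (L *ᵥ v) := by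
  have h1 : star v ⬝ᵥ ((S + Sᴴ) *ᵥ v) = (z + conj z) * (star v ⬝ᵥ v) := by
    rw [Matrix.add_mulVec, dotProduct_add, hv, dotProduct_smul, Matrix.dotProduct_mulVec,
      ← Matrix.star_mulVec, hv, star_smul, smul_dotProduct, add_mul]
    rfl
  rw [← h1, h.lossless, ← Matrix.mulVec_mulVec, Matrix.dotProduct_mulVec, ← Matrix.star_mulVec]

/-- An eigenvector in the kernel of `L` would give `M` an eigenvalue in the closed right
half-plane: `(S, L)` is observable. -/
theorem eq_zero_of_eigenvector_of_mulVec_eq_zero (h : IsLosslessBasis M b S L Z) {v : κ → ℂ} {z : ℂ}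
    (hv : S *ᵥ v = z • v) (hL : L *ᵥ v = 0) : v = 0 := by
  by_contra hne
  have h1 := h.two_re_mul_normSq hv
  rw [hL, dotProduct_zero, mul_eq_zero, or_iff_left (fun h0 => hne (dotProduct_star_self_eq_zero.1 h0)), Complex.add_conj] at h1
  have hre : z.re = 0 := by
    have : 2 * z.re = 0 := by exact_mod_cast h1
    linarith
  have hker : (z • (1 : Matrix ι ι ℂ) - M) *ᵥ (Z *ᵥ v) = 0 := by
    rw [Matrix.sub_mulVec, Matrix.mulVec_mulVec v M, h.sylvester, Matrix.add_mulVec,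
      ← Matrix.mulVec_mulVec, ← Matrix.mulVec_mulVec, hL, hv, Matrix.mulVec_zero, add_zero,
      Matrix.mulVec_smul, Matrix.smul_mulVec, Matrix.one_mulVec, sub_self]
  have hinj := Matrix.mulVec_injective_iff_isUnit.2 (h.hurwitz.isUnit hre.ge)
  exact hne (h.injective v (hinj (by rw [hker, Matrix.mulVec_zero])))

theorem isHurwitz_neg_conjTranspose [DecidableEq κ] (h : IsLosslessBasis M b S L Z) : IsHurwitz (-Sᴴ) := by
  intro z hz
  rw [spectrum.mem_iff, Algebra.algebraMap_eq_smul_one, sub_neg_eq_add,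
    Matrix.isUnit_iff_isUnit_det, isUnit_iff_ne_zero, not_not] at hz
  have hz' : (conj z • (1 : Matrix κ κ ℂ) + S).det = 0 := by
    have := Matrix.det_conjTranspose (z • (1 : Matrix κ κ ℂ) + Sᴴ)
    rw [hz, star_zero] at this
    simpa [Matrix.conjTranspose_add] using this
  obtain ⟨v, hne, hv⟩ := Matrix.exists_mulVec_eq_zero_iff.2 hz'
  have hv' : S *ᵥ v = (-conj z) • v := by
    rw [Matrix.add_mulVec, Matrix.smul_mulVec, Matrix.one_mulVec] at hv
    rw [neg_smul, eq_neg_iff_add_eq_zero, add_comm, hv]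
  have h1 := h.two_re_mul_normSq hv'
  have hLv : L *ᵥ v ≠ 0 := fun hL => hne (h.eq_zero_of_eigenvector_of_mulVec_eq_zero hv' hL)
  have hpos1 : 0 < star v ⬝ᵥ v :=
    Matrix.dotProduct_star_self_pos_iff.2 hne
  have hpos2 : 0 < star (L *ᵥ v) ⬝ᵥ (L *ᵥ v) :=
    Matrix.dotProduct_star_self_pos_iff.2 hLv
  rw [Complex.pos_iff] at hpos1 hpos2
  have h2 := congrArg Complex.re h1
  rw [Complex.add_conj, Complex.re_ofReal_mul] at h2
  simp only [Complex.neg_re, Complex.conj_re] at h2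
  nlinarith [hpos1.1, hpos2.1]

/-- Any factorization `V = Z T` through an invertible `T` turns a solution of the projected
Lyapunov equation that reproduces `Z Zᴴ` into the identity `T Λ T⁻¹ = -Sᴴ`, `T β = -Lᴴ` for the
projected system `(Λ, β)`: its Lyapunov residual is the square of `T β + Lᴴ`. -/
theorem projection_eq [DecidableEq κ] (h : IsLosslessBasis M b S L Z) {ν : Type*} [Fintype ν] [DecidableEq ν]
    {T : Matrix κ ν ℂ} {T' : Matrix ν κ ℂ} (hTT' : T * T' = 1) (hT'T : T' * T = 1)
    {Λ P : Matrix ν ν ℂ} {β : Matrix ν μ ℂ}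
    (hΛ : Λ = T' * S * T + β * (L * T))
    (hlyap : Λ * P + P * Λᴴ + β * βᴴ = 0)
    (hgram : (Z * T) * P * (Z * T)ᴴ = Z * Zᴴ) :
    Λ = T' * -Sᴴ * T ∧ β = T' * -Lᴴ := by
  have hinj : Function.Injective fun X : Matrix κ κ ℂ => Z * X * Zᴴ := by
    obtain ⟨f, hf⟩ := LinearMap.exists_leftInverse_of_injective (Matrix.toLin' Z)
      (LinearMap.ker_eq_bot'.2 fun v hv => h.injective v (by simpa using hv))
    have hW : LinearMap.toMatrix' f * Z = 1 := by
      rw [← LinearMap.toMatrix'_toLin' Z, ← LinearMap.toMatrix'_comp, hf, LinearMap.toMatrix'_id]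
    have hW' : Zᴴ * (LinearMap.toMatrix' f)ᴴ = 1 := by
      rw [← Matrix.conjTranspose_mul, hW, Matrix.conjTranspose_one]
    refine Function.LeftInverse.injective
      (g := fun X => LinearMap.toMatrix' f * X * (LinearMap.toMatrix' f)ᴴ) fun X => ?_
    calc _ = (LinearMap.toMatrix' f * Z) * X * (Zᴴ * (LinearMap.toMatrix' f)ᴴ) := by
          simp only [Matrix.mul_assoc]
      _ = X := by rw [hW, hW', Matrix.one_mul, Matrix.mul_one]
  have hP : T * P * Tᴴ = 1 := by
    apply hinj
    simp only [Matrix.mul_one]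
    rw [← hgram, Matrix.conjTranspose_mul]
    simp only [Matrix.mul_assoc]
  have hTh : Tᴴ * T'ᴴ = 1 := by rw [← Matrix.conjTranspose_mul, hT'T, Matrix.conjTranspose_one]
  have hP' : P = T' * T'ᴴ := by
    calc P = (T' * T) * P * (Tᴴ * T'ᴴ) := by rw [hT'T, hTh, Matrix.one_mul, Matrix.mul_one]
      _ = T' * (T * P * Tᴴ) * T'ᴴ := by simp only [Matrix.mul_assoc]
      _ = _ := by rw [hP, Matrix.mul_one]
  have hTΛ : T * Λ * T' = S + T * β * L := by
    rw [hΛ, Matrix.mul_add, Matrix.add_mul]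
    congr 1
    · calc T * (T' * S * T) * T' = (T * T') * S * (T * T') := by simp only [Matrix.mul_assoc]
        _ = S := by rw [hTT', Matrix.one_mul, Matrix.mul_one]
    · calc T * (β * (L * T)) * T' = T * β * L * (T * T') := by simp only [Matrix.mul_assoc]
        _ = _ := by rw [hTT', Matrix.mul_one]
  have hres : (T * β + Lᴴ) * (T * β + Lᴴ)ᴴ = 0 := by
    have e1 : T * Λ * T' + (T * Λ * T')ᴴ + T * β * (T * β)ᴴ = 0 := by
      calc T * Λ * T' + (T * Λ * T')ᴴ + T * β * (T * β)ᴴ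
          = T * Λ * T' * (T'ᴴ * Tᴴ)  + (T * T') * (T'ᴴ * Λᴴ * Tᴴ) + T * β * (βᴴ * Tᴴ) := by
            rw [← Matrix.conjTranspose_mul T T', hTT', Matrix.conjTranspose_one, Matrix.mul_one,
              Matrix.one_mul]
            simp only [Matrix.conjTranspose_mul, Matrix.mul_assoc]
        _ = T * (Λ * P + P * Λᴴ + β * βᴴ) * Tᴴ := by
            rw [hP']; simp only [Matrix.mul_add, Matrix.add_mul, Matrix.mul_assoc]
        _ = 0 := by rw [hlyap, Matrix.mul_zero, Matrix.zero_mul]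
    rw [hTΛ, Matrix.conjTranspose_add, add_add_add_comm, h.lossless] at e1
    rw [Matrix.conjTranspose_add, Matrix.conjTranspose_conjTranspose, Matrix.add_mul,
      Matrix.mul_add, Matrix.mul_add, ← e1, Matrix.conjTranspose_mul (T * β) L]
    abel
  have hβ : T * β = -Lᴴ := by
    rw [eq_neg_iff_add_eq_zero]; exact Matrix.self_mul_conjTranspose_eq_zero.1 hres
  have hβ' : β = T' * -Lᴴ := by
    rw [← hβ, ← Matrix.mul_assoc, hT'T, Matrix.one_mul]
  refine ⟨?_, hβ'⟩
  have hTΛ' : T * Λ * T' = -Sᴴ := by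
    rw [hTΛ, hβ, Matrix.neg_mul, ← h.lossless]; abel
  rw [← hTΛ']
  calc Λ = (T' * T) * Λ * (T' * T) := by rw [hT'T, Matrix.one_mul, Matrix.mul_one]
    _ = _ := by simp only [Matrix.mul_assoc]

/-- On the imaginary axis, if `Y` commutes with `S`, the product of the error with the
system `(-Sᴴ, -(L Y)ᴴ, c')` factors through functions that are holomorphic in the right half-plane. -/
theorem error_mul_conjTranspose {α : Type*} [DecidableEq κ] (h : IsLosslessBasis M b S L Z)
    {Y : Matrix κ κ ℂ} (hY : S * Y = Y * S) (C : Matrix α ι ℂ) (c' : Matrix α κ ℂ) {z : ℂ}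
    (hz : z.re = 0) :
    (C * (z • 1 - M)⁻¹ * b - C * Z * (z • 1 - -Sᴴ)⁻¹ * -Lᴴ) *
        (c' * (z • 1 - -Sᴴ)⁻¹ * -(L * Y)ᴴ)ᴴ =
      (C * (z • 1 - M)⁻¹ * (Z * Sᴴ + M * Z)) * ((z • 1 - -Sᴴ)⁻¹ * (Y * c'ᴴ)) := by
  have hM := h.hurwitz.isUnit hz.ge
  have hS := h.isHurwitz_neg_conjTranspose.isUnit hz.ge
  rw [Matrix.isUnit_iff_isUnit_det] at hM hS
  set D := z • (1 : Matrix ι ι ℂ) - M with hD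
  set D' := z • (1 : Matrix κ κ ℂ) - -Sᴴ with hD'
  have hconj : conj z = -z := by
    apply Complex.ext <;> simp [hz]
  have hD'S : D'ᴴ = S - z • 1 := by
    rw [hD']; simp [hconj, sub_eq_add_neg, add_comm]
  have hSunit : IsUnit (S - z • (1 : Matrix κ κ ℂ)).det := by
    rw [← hD'S, Matrix.det_conjTranspose]; exact hS.star
  set c := c'ᴴ
  set K := (S - z • (1 : Matrix κ κ ℂ))⁻¹ with hK
  have hbL : b * L = -(D * Z) - Z * (S - z • 1) := by
    rw [hD, Matrix.sub_mul, Matrix.mul_sub, h.sylvester]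
    simp only [Matrix.smul_mul, Matrix.one_mul, Matrix.mul_smul, Matrix.mul_one]
    abel
  have hLL : Lᴴ * L = D' + (S - z • 1) := by
    rw [← h.lossless, hD']; abel
  have hYK : (S - z • 1) * (Y * K) = Y := by
    rw [← Matrix.mul_assoc, Matrix.sub_mul, hY, Matrix.smul_mul, Matrix.one_mul,
      ← Matrix.mul_one (z • Y), Matrix.smul_mul, ← Matrix.mul_smul, ← Matrix.mul_sub,
      Matrix.mul_assoc, Matrix.mul_nonsing_inv _ hSunit, Matrix.mul_one]
  have hZ : Z * Sᴴ + M * Z = Z * D' - D * Z := by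
    rw [hD, hD', Matrix.mul_sub, Matrix.sub_mul]
    simp only [Matrix.smul_mul, Matrix.one_mul, Matrix.mul_smul, Matrix.mul_one, Matrix.mul_neg]
    abel
  have hleft : (c' * D'⁻¹ * -(L * Y)ᴴ)ᴴ = -(L * (Y * K) * c) := by
    rw [Matrix.conjTranspose_mul (c' * D'⁻¹), Matrix.conjTranspose_mul c',
      Matrix.conjTranspose_nonsing_inv, hD'S, Matrix.conjTranspose_neg,
      Matrix.conjTranspose_conjTranspose]
    simp only [Matrix.neg_mul, Matrix.mul_assoc]
    rfl
  have e1 : C * D⁻¹ * b * (L * (Y * K) * c) = -(C * Z * (Y * K) * c) - C * D⁻¹ * Z * Y * c := by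
    calc C * D⁻¹ * b * (L * (Y * K) * c) = C * D⁻¹ * (b * L) * (Y * K) * c := by
          simp only [Matrix.mul_assoc]
      _ = -(C * (D⁻¹ * D) * Z * (Y * K) * c) - C * D⁻¹ * Z * ((S - z • 1) * (Y * K)) * c := by
          rw [hbL]
          simp only [Matrix.mul_sub, Matrix.sub_mul, Matrix.mul_neg, Matrix.neg_mul,
            Matrix.mul_assoc]
      _ = _ := by rw [hYK, Matrix.nonsing_inv_mul _ hM, Matrix.mul_one]
  have e2 : C * Z * D'⁻¹ * Lᴴ * (L * (Y * K) * c) =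
      C * Z * (Y * K) * c + C * Z * D'⁻¹ * Y * c := by
    calc C * Z * D'⁻¹ * Lᴴ * (L * (Y * K) * c) = C * Z * D'⁻¹ * (Lᴴ * L) * (Y * K) * c := by
          simp only [Matrix.mul_assoc]
      _ = C * Z * (D'⁻¹ * D') * (Y * K) * c + C * Z * D'⁻¹ * ((S - z • 1) * (Y * K)) * c := by
          rw [hLL]
          simp only [Matrix.mul_add, Matrix.add_mul, Matrix.mul_assoc]
      _ = _ := by rw [hYK, Matrix.nonsing_inv_mul _ hS, Matrix.mul_one]
  rw [hleft, hZ, Matrix.mul_neg, Matrix.mul_neg, sub_neg_eq_add, Matrix.add_mul, e1, e2]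
  have e3 : C * D⁻¹ * (Z * D' - D * Z) * (D'⁻¹ * (Y * c)) =
      C * D⁻¹ * Z * (D' * D'⁻¹) * Y * c - C * (D⁻¹ * D) * Z * D'⁻¹ * Y * c := by
    simp only [Matrix.mul_sub, Matrix.sub_mul, Matrix.mul_assoc]
  rw [e3, Matrix.mul_nonsing_inv _ hS, Matrix.nonsing_inv_mul _ hM, Matrix.mul_one, Matrix.mul_one]
  abel

end IsLosslessBasis

/-! ### The Sylvester equation of the ADI basis -/

section ADISylvester

variable {ι μ : Type*} [Fintype ι] [DecidableEq ι] [Fintype μ] [DecidableEq μ]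

/-- The small triangular coefficient matrix of the ADI iteration, with the shifts on its diagonal. -/
noncomputable def adiTriangular (σ : ℕ → ℂ) (k : ℕ) : Matrix (Fin k) (Fin k) ℂ :=
  Matrix.of fun i j => if i = j then σ i else
    if i < j then (adiWeight σ i : ℂ) * adiWeight σ j else 0

/-- `adiTriangular ⊗ I`, the matrix `S` in the Sylvester equation `M Z = Z S + b L`. -/
noncomputable def adiS (μ : Type*) [DecidableEq μ] (σ : ℕ → ℂ) (k : ℕ) :
    Matrix (Fin k × μ) (Fin k × μ) ℂ :=
  Matrix.of fun x y => if x.2 = y.2 then adiTriangular σ k x.1 y.1 else 0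

/-- The matrix `L` in the Sylvester equation `M Z = Z S + b L`: a row of scaled identities. -/
noncomputable def adiL (μ : Type*) [DecidableEq μ] (σ : ℕ → ℂ) (k : ℕ) :
    Matrix μ (Fin k × μ) ℂ :=
  Matrix.of fun a y => if a = y.2 then (adiWeight σ y.1 : ℂ) else 0

/-- The first `k` ADI blocks for the pair `(M, b)`, side by side. -/
noncomputable def adiMatrix (M : Matrix ι ι ℂ) (b : Matrix ι μ ℂ) (σ : ℕ → ℂ) (k : ℕ) :
    Matrix ι (Fin k × μ) ℂ :=
  Matrix.of fun r y => adiSeq M b σ y.1 r y.2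

variable {M : Matrix ι ι ℂ} {b : Matrix ι μ ℂ} {σ : ℕ → ℂ}

theorem adiMatrix_sylvester (hM : IsHurwitz M) (hσ : ∀ i, 0 < (σ i).re) (k : ℕ) :
    M * adiMatrix M b σ k = adiMatrix M b σ k * adiS μ σ k + b * adiL μ σ k := by
  ext r ⟨j, c⟩
  have h1 : (M * adiMatrix M b σ k) r (j, c) = (M * adiSeq M b σ j) r c := by
    simp [Matrix.mul_apply, adiMatrix]
  have h2 : (b * adiL μ σ k) r (j, c) = adiWeight σ j * b r c := by
    simp [Matrix.mul_apply, adiL, mul_comm]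
  have h3 : (adiMatrix M b σ k * adiS μ σ k) r (j, c) =
      ∑ i : Fin k, adiSeq M b σ i r c * adiTriangular σ k i j := by
    simp [Matrix.mul_apply, adiMatrix, adiS, Fintype.sum_prod_type]
  have h4 : ∑ i : Fin k, adiSeq M b σ i r c * adiTriangular σ k i j =
      σ j * adiSeq M b σ j r c +
        ∑ i ∈ Finset.range j, adiSeq M b σ i r c * (adiWeight σ i * adiWeight σ j) := by
    let g : ℕ → ℂ := fun i => (if i = j then σ j * adiSeq M b σ j r c else 0) +
      if i < j then adiSeq M b σ i r c * (adiWeight σ i * adiWeight σ j) else 0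
    have h5 : ∀ i : Fin k, adiSeq M b σ i r c * adiTriangular σ k i j = g i := by
      intro i
      simp only [adiTriangular, Matrix.of_apply, g]
      rcases lt_trichotomy i j with h | h | h
      · have h' : (i : ℕ) < j := h
        simp [h, h.ne, h', h'.ne]
      · simp [h, mul_comm]
      · have h' : (j : ℕ) < i := h
        simp [h.ne', h.not_gt, h'.ne', h'.not_gt]
    rw [Finset.sum_congr rfl fun i _ => h5 i, Fin.sum_univ_eq_sum_range g k, Finset.sum_add_distrib,
      Finset.sum_ite_eq' (Finset.range k) (j : ℕ), if_pos (Finset.mem_range.2 j.2),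
      ← Finset.sum_filter]
    congr 1
    refine Finset.sum_congr ?_ fun _ _ => rfl
    ext i
    have := j.2
    simp only [Finset.mem_filter, Finset.mem_range]
    omega
  rw [Matrix.add_apply, h1, h2, h3, h4, mul_adiSeq hM (hσ j), adiResidual_eq_sum hM hσ]
  simp only [Matrix.add_apply, Matrix.smul_apply, smul_eq_mul, Matrix.sum_apply, mul_add,
    Finset.mul_sum]
  rw [add_comm (_ * b r c), ← add_assoc]
  congr 2
  exact Finset.sum_congr rfl fun i _ => by ring

theorem adiS_add_conjTranspose (hσ : ∀ i, 0 < (σ i).re) (k : ℕ) :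
    adiS μ σ k + (adiS μ σ k)ᴴ = (adiL μ σ k)ᴴ * adiL μ σ k := by
  ext ⟨i, a⟩ ⟨j, c⟩
  simp only [Matrix.add_apply, Matrix.conjTranspose_apply, Matrix.mul_apply, adiS, adiL,
    adiTriangular, Matrix.of_apply]
  by_cases hac : a = c
  · subst hac
    rw [Finset.sum_eq_single a (fun x _ hx => by simp [hx]) (by simp)]
    rcases lt_trichotomy i j with h | h | h
    · simp [h, h.ne, h.ne', h.not_gt]
    · subst h
      simpa using (adiWeight_mul_self (hσ i)).symm
    · simp [h, h.ne, h.ne', h.not_gt, mul_comm]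
  · rw [Finset.sum_eq_zero]
    · simp [hac, Ne.symm hac]
    · intro x _
      by_cases hx : x = a
      · subst hx; simp [hac]
      · simp [hx]

theorem isLosslessBasis_adiMatrix (hM : IsHurwitz M) (hσ : ∀ i, 0 < (σ i).re) {k : ℕ}
    (hinj : ∀ v, adiMatrix M b σ k *ᵥ v = 0 → v = 0) :
    IsLosslessBasis M b (adiS μ σ k) (adiL μ σ k) (adiMatrix M b σ k) :=
  ⟨hM, adiMatrix_sylvester hM hσ k, adiS_add_conjTranspose hσ k, hinj⟩

/-- A row `γ` and a square matrix `s` without an eigenvector in the kernel of `γ` form an observable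
pair, so the rows `γ y`, with `y` in the centralizer of `s`, are all rows. -/
theorem exists_commute_vecMul_eq {κ : Type*} [Fintype κ] [DecidableEq κ] (s : Matrix κ κ ℂ)
    (γ : κ → ℂ) (hobs : ∀ v (z : ℂ), s *ᵥ v = z • v → γ ⬝ᵥ v = 0 → v = 0) (r : κ → ℂ) :
    ∃ y, s * y = y * s ∧ γ ᵥ* y = r := by
  let R : Submodule ℂ (κ → ℂ) :=
    { carrier := {r | ∃ y, s * y = y * s ∧ γ ᵥ* y = r}
      add_mem' := by
        rintro _ _ ⟨y, hy, rfl⟩ ⟨y', hy', rfl⟩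
        exact ⟨y + y', by rw [mul_add, add_mul, hy, hy'], Matrix.vecMul_add _ _ _⟩
      zero_mem' := ⟨0, by simp, by simp⟩
      smul_mem' := by
        rintro c _ ⟨y, hy, rfl⟩
        exact ⟨c • y, by rw [mul_smul_comm, smul_mul_assoc, hy], Matrix.vecMul_smul _ _ _⟩ }
  let N : Submodule ℂ (κ → ℂ) :=
    { carrier := {v | ∀ r ∈ R, r ⬝ᵥ v = 0}
      add_mem' := fun hv hw r hr => by rw [dotProduct_add, hv r hr, hw r hr, add_zero]
      zero_mem' := fun r _ => dotProduct_zero r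
      smul_mem' := fun c v hv r hr => by rw [dotProduct_smul, hv r hr, smul_zero] }
  have hN : ∀ v ∈ N, s.mulVecLin v ∈ N := by
    rintro v hv _ ⟨y, hy, rfl⟩
    rw [Matrix.mulVecLin_apply, Matrix.dotProduct_mulVec, Matrix.vecMul_vecMul]
    exact hv _ ⟨y * s, by rw [← mul_assoc, hy], rfl⟩
  have hNbot : N = ⊥ := by
    by_contra hne
    have : Nontrivial N := Submodule.nontrivial_iff_ne_bot.2 hne
    obtain ⟨z, hz⟩ := Module.End.exists_eigenvalue (s.mulVecLin.restrict hN)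
    obtain ⟨v, hv⟩ := hz.exists_hasEigenvector
    have h1 : s *ᵥ (v : κ → ℂ) = z • (v : κ → ℂ) := congrArg Subtype.val hv.apply_eq_smul
    have h2 : γ ⬝ᵥ (v : κ → ℂ) = 0 := v.2 γ ⟨1, by simp, by simp⟩
    exact hv.2 (Subtype.ext (hobs _ _ h1 h2))
  change r ∈ R
  by_contra hr
  obtain ⟨f, hfr, hf⟩ := Submodule.exists_le_ker_of_notMem hr
  have hfv : ∀ x : κ → ℂ, f x = x ⬝ᵥ fun i => f (Pi.single i 1) := fun x => by
    conv_lhs => rw [pi_eq_sum_univ' x]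
    simp [dotProduct, map_sum]
  have hmem : (fun i => f (Pi.single i 1)) ∈ N := fun x hx => by
    rw [← hfv]; exact hf hx
  rw [hNbot, Submodule.mem_bot] at hmem
  exact hfr (by rw [hfv, hmem, dotProduct_zero])

/-- Because the coefficient matrix of the ADI basis is a Kronecker product with the identity, its
centralizer is large enough to prescribe `L Y`. -/
theorem exists_commute_adiS {k : ℕ}
    (h : IsLosslessBasis M b (adiS μ σ k) (adiL μ σ k) (adiMatrix M b σ k))
    (β : Matrix μ (Fin k × μ) ℂ) :
    ∃ Y, adiS μ σ k * Y = Y * adiS μ σ k ∧ adiL μ σ k * Y = β := by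
  rcases isEmpty_or_nonempty μ with hμ | ⟨⟨c⟩⟩
  · exact ⟨0, by simp, by ext a; exact hμ.elim a⟩
  have hobs : ∀ (v : Fin k → ℂ) (z : ℂ), adiTriangular σ k *ᵥ v = z • v →
      (fun i : Fin k => (adiWeight σ i : ℂ)) ⬝ᵥ v = 0 → v = 0 := by
    intro v z hv hγ
    have h0 := h.eq_zero_of_eigenvector_of_mulVec_eq_zero (z := z)
      (v := fun x => if x.2 = c then v x.1 else 0) (by
        ext ⟨i, a⟩
        have := congrFun hv i
        simp only [Matrix.mulVec, dotProduct, Pi.smul_apply, smul_eq_mul] at this ⊢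
        by_cases hac : a = c
        · simp [adiS, Fintype.sum_prod_type, hac, this]
        · simp [adiS, Fintype.sum_prod_type, hac]) (by
        ext a
        simp only [Matrix.mulVec, dotProduct] at hγ ⊢
        by_cases hac : a = c
        · simp [adiL, Fintype.sum_prod_type, hac, hγ]
        · simp [adiL, Fintype.sum_prod_type, hac])
    ext i
    simpa using congrFun h0 (i, c)
  choose y hy hy' using fun a c => exists_commute_vecMul_eq (adiTriangular σ k) _ hobs
    fun j => β a (j, c)
  refine ⟨Matrix.of fun x w => y x.2 w.2 x.1 w.1, ?_, ?_⟩
  · ext ⟨i, a⟩ ⟨j, c⟩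
    simpa [Matrix.mul_apply, adiS, Fintype.sum_prod_type] using congrFun (congrFun (hy a c) i) j
  · ext a ⟨j, c⟩
    simpa [Matrix.mul_apply, adiL, Fintype.sum_prod_type, Matrix.vecMul, dotProduct] using
      congrFun (hy' a c) j

end ADISylvester

/-! ### Orthogonality in `H₂` -/

section H2

variable {p m : ℕ}

/-- All entries of the matrix-valued function satisfy `HardyDecay`. -/
def MatrixHardyDecay {α β : Type*} (F : ℂ → Matrix α β ℂ) : Prop :=
  ∀ i j, HardyDecay fun z => F z i j

theorem MatrixHardyDecay.add {α β : Type*} {F K : ℂ → Matrix α β ℂ} (hF : MatrixHardyDecay F)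
    (hK : MatrixHardyDecay K) : MatrixHardyDecay (F + K) :=
  fun i j => (hF i j).add (hK i j)

theorem MatrixHardyDecay.sub {α β : Type*} {F K : ℂ → Matrix α β ℂ} (hF : MatrixHardyDecay F)
    (hK : MatrixHardyDecay K) : MatrixHardyDecay (F - K) :=
  fun i j => (hF i j).sub (hK i j)

/-- The integrand of the `H₂` inner product. -/
noncomputable def h2Pairing (F K : ℂ → Matrix (Fin p) (Fin m) ℂ) (ω : ℝ) : ℂ :=
  (F (Complex.I * ω) * (K (Complex.I * ω))ᴴ).trace

variable {F K : ℂ → Matrix (Fin p) (Fin m) ℂ}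

theorem h2Pairing_integrable (hF : MatrixHardyDecay F) (hK : MatrixHardyDecay K) :
    MeasureTheory.Integrable (h2Pairing F K) := by
  have : h2Pairing F K = fun ω : ℝ => ∑ i, ∑ j,
      F (Complex.I * ω) i j * star (K (Complex.I * ω) i j) := by
    funext ω
    simp only [h2Pairing, Matrix.trace, Matrix.diag_apply, Matrix.mul_apply,
      Matrix.conjTranspose_apply]
  rw [this]
  exact MeasureTheory.integrable_finsetSum _ fun i _ => MeasureTheory.integrable_finsetSum _
    fun j _ => (hF i j).memLp_imaginaryAxis.integrable_mul (hK i j).memLp_imaginaryAxis.star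

theorem h2Integrand_eq_h2Pairing (F : ℂ → Matrix (Fin p) (Fin m) ℂ) :
    h2Integrand F = h2Pairing F F := by
  funext ω
  simp only [h2Integrand, h2Pairing, Matrix.trace, Matrix.diag_apply, Matrix.mul_apply,
    Matrix.conjTranspose_apply, Matrix.transpose_apply, Matrix.map_apply]
  exact Finset.sum_congr rfl fun i _ => Finset.sum_congr rfl fun j _ => mul_comm _ _

theorem MatrixHardyDecay.hasFiniteH2Norm (hF : MatrixHardyDecay F) : HasFiniteH2Norm F := by
  rw [HasFiniteH2Norm, h2Integrand_eq_h2Pairing]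
  exact h2Pairing_integrable hF hF

theorem h2Pairing_self_re_nonneg (F : ℂ → Matrix (Fin p) (Fin m) ℂ) (ω : ℝ) :
    0 ≤ (h2Pairing F F ω).re := by
  simp only [h2Pairing, Matrix.trace, Matrix.diag_apply, Matrix.mul_apply,
    Matrix.conjTranspose_apply, Complex.re_sum]
  refine Finset.sum_nonneg fun i _ => Finset.sum_nonneg fun j _ => ?_
  rw [Complex.star_def, Complex.mul_conj, Complex.ofReal_re]
  exact Complex.normSq_nonneg _

/-- The inequality in the Pythagorean theorem for `F ⊥ K`. -/
theorem h2Norm_le_h2Norm_add (hF : MatrixHardyDecay F) (hK : MatrixHardyDecay K)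
    (h : ∫ ω, h2Pairing F K ω = 0) : h2Norm F ≤ h2Norm (F + K) := by
  have hpt : ∀ ω, (h2Pairing (F + K) (F + K) ω).re =
      (h2Pairing F F ω).re + ((h2Pairing K K ω).re + 2 * (h2Pairing F K ω).re) := by
    intro ω
    have h1 : h2Pairing K F ω = conj (h2Pairing F K ω) := by
      rw [h2Pairing, h2Pairing, starRingEnd_apply, ← Matrix.trace_conjTranspose,
        Matrix.conjTranspose_mul, Matrix.conjTranspose_conjTranspose]
    have h2 : h2Pairing (F + K) (F + K) ω =
        h2Pairing F F ω + h2Pairing K F ω + (h2Pairing F K ω + h2Pairing K K ω) := by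
      simp only [h2Pairing, Pi.add_apply, Matrix.conjTranspose_add, Matrix.mul_add, Matrix.add_mul,
        Matrix.trace_add]
    rw [h2, h1]
    simp only [Complex.add_re, Complex.conj_re]
    ring
  have hFF := (h2Pairing_integrable hF hF).re
  have hKK := (h2Pairing_integrable hK hK).re
  have hFK := (h2Pairing_integrable hF hK).re
  have hcross : ∫ ω, (h2Pairing F K ω).re = 0 := by
    have := integral_re (𝕜 := ℂ) (h2Pairing_integrable hF hK)
    rw [h] at this
    simpa using this
  simp only [RCLike.re_eq_complex_re] at hFF hKK hFK
  refine Real.sqrt_le_sqrt (mul_le_mul_of_nonneg_left ?_ (by positivity))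
  rw [h2Integrand_eq_h2Pairing, h2Integrand_eq_h2Pairing]
  simp_rw [hpt]
  have hsum : MeasureTheory.Integrable
      fun ω => (h2Pairing K K ω).re + 2 * (h2Pairing F K ω).re := hKK.add (hFK.const_mul 2)
  rw [MeasureTheory.integral_add hFF hsum,
    MeasureTheory.integral_add hKK (hFK.const_mul 2), MeasureTheory.integral_const_mul, hcross,
    mul_zero, add_zero]
  exact le_add_of_nonneg_right
    (MeasureTheory.integral_nonneg fun ω => h2Pairing_self_re_nonneg K ω)

/-- The error is orthogonal to every system with state matrix `-Sᴴ`, provided that the centralizer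
of `S` lets `L Y` be prescribed. -/
theorem IsLosslessBasis.integral_h2Pairing_eq_zero {ι κ : Type*} [Fintype ι] [DecidableEq ι]
    [Fintype κ] [DecidableEq κ] {M : Matrix ι ι ℂ} {b : Matrix ι (Fin m) ℂ} {S : Matrix κ κ ℂ}
    {L : Matrix (Fin m) κ ℂ} {Z : Matrix ι κ ℂ} (h : IsLosslessBasis M b S L Z)
    (hcomm : ∀ β, ∃ Y, S * Y = Y * S ∧ L * Y = β) (C : Matrix (Fin p) ι ℂ)
    (c' : Matrix (Fin p) κ ℂ) (β : Matrix κ (Fin m) ℂ) :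
    ∫ ω, h2Pairing
      (fun z => C * (z • 1 - M)⁻¹ * b - C * Z * (z • 1 - -Sᴴ)⁻¹ * -Lᴴ)
      (fun z => c' * (z • 1 - -Sᴴ)⁻¹ * β) ω = 0 := by
  obtain ⟨Y, hY, hLY⟩ := hcomm (-βᴴ)
  have hβ : β = -(L * Y)ᴴ := by simp [hLY]
  have hX := h.hurwitz.hardyDecay_mul_resolvent_mul C (Z * Sᴴ + M * Z)
  have hW := h.isHurwitz_neg_conjTranspose.hardyDecay_mul_resolvent_mul
    (1 : Matrix κ κ ℂ) (Y * c'ᴴ)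
  simp only [Matrix.one_mul] at hW
  have hpt : ∀ ω : ℝ, h2Pairing
      (fun z => C * (z • 1 - M)⁻¹ * b - C * Z * (z • 1 - -Sᴴ)⁻¹ * -Lᴴ)
      (fun z => c' * (z • 1 - -Sᴴ)⁻¹ * β) ω = ∑ i, ∑ j,
        (C * ((Complex.I * ω) • 1 - M)⁻¹ * (Z * Sᴴ + M * Z)) i j *
          (((Complex.I * ω) • 1 - -Sᴴ)⁻¹ * (Y * c'ᴴ)) j i := by
    intro ω
    rw [h2Pairing, hβ, h.error_mul_conjTranspose hY C c' (by simp)]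
    simp only [Matrix.trace, Matrix.diag_apply, Matrix.mul_apply]
  simp_rw [hpt]
  have hint : ∀ i j, MeasureTheory.Integrable fun ω : ℝ =>
      (C * ((Complex.I * ω) • 1 - M)⁻¹ * (Z * Sᴴ + M * Z)) i j *
        (((Complex.I * ω) • 1 - -Sᴴ)⁻¹ * (Y * c'ᴴ)) j i := fun i j =>
    (hX i j).memLp_imaginaryAxis.integrable_mul (hW j i).memLp_imaginaryAxis
  rw [MeasureTheory.integral_finsetSum _ fun i _ =>
    MeasureTheory.integrable_finsetSum _ fun j _ => hint i j]
  refine Finset.sum_eq_zero fun i _ => ?_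
  rw [MeasureTheory.integral_finsetSum _ fun j _ => hint i j]
  exact Finset.sum_eq_zero fun j _ => (hX i j).integral_mul_eq_zero (hW j i)

end H2

/-! ### Real descriptor systems as complex ones -/

section Realization

theorem toC_mul {a b c : Type*} [Fintype b] (X : Matrix a b ℝ) (Y : Matrix b c ℝ) :
    toC (X * Y) = toC X * toC Y := by
  ext i j
  simp [Matrix.mul_apply]

theorem toC_add {a b : Type*} (X Y : Matrix a b ℝ) : toC (X + Y) = toC X + toC Y := by
  ext i j
  simp

theorem toC_transpose {a b : Type*} (X : Matrix a b ℝ) : toC Xᵀ = (toC X)ᴴ := by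
  ext i j
  simp

theorem toC_one {a : Type*} [DecidableEq a] : toC (1 : Matrix a a ℝ) = 1 := by
  ext i j
  simp [Matrix.one_apply, apply_ite]

theorem toC_zero {a b : Type*} : toC (0 : Matrix a b ℝ) = 0 := by
  ext i j
  simp

variable {n m p : ℕ} {E : Matrix (Fin n) (Fin n) ℝ}

theorem toC_mul_toC_inv (hE : IsUnit E.det) : toC E * toC E⁻¹ = 1 := by
  rw [← toC_mul, Matrix.mul_nonsing_inv _ hE, toC_one]

theorem toC_inv_mul_toC (hE : IsUnit E.det) : toC E⁻¹ * toC E = 1 := by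
  rw [← toC_mul, Matrix.nonsing_inv_mul _ hE, toC_one]

theorem pencil_inv (hE : IsUnit E.det) (A : Matrix (Fin n) (Fin n) ℝ) (z : ℂ) :
    (toC A - z • toC E)⁻¹ = (toC (E⁻¹ * A) - z • (1 : Matrix (Fin n) (Fin n) ℂ))⁻¹ * toC E⁻¹ := by
  have h : toC A - z • toC E =
      toC E * (toC (E⁻¹ * A) - z • (1 : Matrix (Fin n) (Fin n) ℂ)) := by
    rw [toC_mul, Matrix.mul_sub, ← Matrix.mul_assoc, toC_mul_toC_inv hE, Matrix.one_mul,
      Matrix.mul_smul, Matrix.mul_one]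
  rw [h, Matrix.mul_inv_rev, Matrix.inv_eq_right_inv (toC_mul_toC_inv hE)]

theorem transferFunction_eq (hE : IsUnit E.det) (A : Matrix (Fin n) (Fin n) ℝ)
    (B : Matrix (Fin n) (Fin m) ℝ) (C : Matrix (Fin p) (Fin n) ℝ) :
    transferFunction E A B C = fun z => toC C *
      (z • (1 : Matrix (Fin n) (Fin n) ℂ) - toC (E⁻¹ * A))⁻¹ * toC (E⁻¹ * B) := by
  funext z
  have h : z • toC E - toC A =
      toC E * (z • (1 : Matrix (Fin n) (Fin n) ℂ) - toC (E⁻¹ * A)) := by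
    rw [toC_mul, Matrix.mul_sub, ← Matrix.mul_assoc, toC_mul_toC_inv hE, Matrix.one_mul,
      Matrix.mul_smul, Matrix.mul_one]
  rw [transferFunction, h, Matrix.mul_inv_rev, Matrix.inv_eq_right_inv (toC_mul_toC_inv hE),
    toC_mul E⁻¹ B]
  simp only [Matrix.mul_assoc]

/-- A similarity between matrices with different index types carries resolvents to resolvents, also
at the eigenvalues, where both inverses are `0`. -/
theorem resolvent_similar {α β : Type*} [Fintype α] [DecidableEq α] [Fintype β] [DecidableEq β]
    {X : Matrix α β ℂ} {Y : Matrix β α ℂ} (hXY : X * Y = 1) (hYX : Y * X = 1) (N : Matrix β β ℂ)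
    (z : ℂ) : (z • 1 - X * N * Y)⁻¹ = X * (z • 1 - N)⁻¹ * Y := by
  have h1 : z • 1 - X * N * Y = X * (z • 1 - N) * Y := by
    rw [Matrix.mul_sub, Matrix.sub_mul, Matrix.mul_smul, Matrix.mul_one, Matrix.smul_mul, hXY]
  rw [h1]
  set W := z • 1 - N
  by_cases hW : IsUnit W.det
  · refine Matrix.inv_eq_right_inv ?_
    calc X * W * Y * (X * W⁻¹ * Y) = X * (W * ((Y * X) * W⁻¹)) * Y := by
          simp only [Matrix.mul_assoc]
      _ = 1 := by rw [hYX, Matrix.one_mul, Matrix.mul_nonsing_inv _ hW, Matrix.mul_one, hXY]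
  · have hW' : ¬ IsUnit (X * W * Y).det := by
      intro hu
      refine hW ((Matrix.isUnit_iff_isUnit_det _).1 (IsUnit.of_mul_eq_one (Y * (X * W * Y)⁻¹ * X) ?_))
      calc W * (Y * (X * W * Y)⁻¹ * X) = (Y * X) * W * (Y * (X * W * Y)⁻¹ * X) := by
            rw [hYX, Matrix.one_mul]
        _ = Y * ((X * W * Y) * (X * W * Y)⁻¹) * X := by simp only [Matrix.mul_assoc]
        _ = 1 := by rw [Matrix.mul_nonsing_inv _ hu, Matrix.mul_one, hYX]
    rw [Matrix.nonsing_inv_apply_not_isUnit _ hW', Matrix.nonsing_inv_apply_not_isUnit _ hW,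
      Matrix.mul_zero, Matrix.zero_mul]

theorem SameJordanForm.exists_similar {q : ℕ} {M N : Matrix (Fin q) (Fin q) ℂ}
    (h : SameJordanForm M N) : ∃ X Y : Matrix (Fin q) (Fin q) ℂ,
      X * Y = 1 ∧ Y * X = 1 ∧ M = X * N * Y := by
  obtain ⟨r, μ, d, ⟨-, P, Q, hPQ, hQP, hM⟩, -, P', Q', hPQ', hQP', hN⟩ := h
  refine ⟨P * Q', P' * Q, ?_, ?_, ?_⟩
  · calc P * Q' * (P' * Q) = P * (Q' * P') * Q := by simp only [Matrix.mul_assoc]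
      _ = 1 := by rw [hQP', Matrix.mul_one, hPQ]
  · calc P' * Q * (P * Q') = P' * (Q * P) * Q' := by simp only [Matrix.mul_assoc]
      _ = 1 := by rw [hQP, Matrix.mul_one, hPQ']
  · rw [hM, hN]
    generalize Matrix.blockDiagonal' (fun i => jordanBlock (μ i) (d i)) = J
    calc P * J * Q = P * ((Q' * P') * J * (Q' * P')) * Q := by
          rw [hQP', Matrix.one_mul, Matrix.mul_one]
      _ = _ := by simp only [Matrix.mul_assoc]

/-- All systems with the same Jordan form as `(E, A)` have realizations with any prescribed state
matrix `N` similar to `E⁻¹ A`. -/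
theorem exists_realization_of_mem_sameJordanSystems {q : ℕ} {κ : Type*} [Fintype κ] [DecidableEq κ]
    {E A : Matrix (Fin q) (Fin q) ℝ} {N : Matrix κ κ ℂ} {T : Matrix κ (Fin q) ℂ}
    {T' : Matrix (Fin q) κ ℂ} (hTT' : T * T' = 1) (hT'T : T' * T = 1)
    (hN : toC (E⁻¹ * A) = T' * N * T) {H : ℂ → Matrix (Fin p) (Fin m) ℂ}
    (hH : H ∈ sameJordanSystems p m E A) :
    ∃ (c' : Matrix (Fin p) κ ℂ) (β : Matrix κ (Fin m) ℂ), H = fun z => c' * (z • 1 - N)⁻¹ * β := by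
  obtain ⟨E', A', B', C', hE', hJ, rfl⟩ := hH
  obtain ⟨X, Y, hXY, hYX, hX⟩ := hJ.exists_similar
  refine ⟨toC C' * X * T', T * Y * toC (E'⁻¹ * B'), ?_⟩
  rw [transferFunction_eq hE', hX, hN]
  funext z
  rw [resolvent_similar hXY hYX, resolvent_similar hT'T hTT']
  simp only [Matrix.mul_assoc]

theorem transferFunction_mem_sameJordanSystems (hE : IsUnit E.det) (A : Matrix (Fin n) (Fin n) ℝ)
    (B : Matrix (Fin n) (Fin m) ℝ) (C : Matrix (Fin p) (Fin n) ℝ) :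
    transferFunction E A B C ∈ sameJordanSystems p m E A := by
  obtain ⟨r, μ, d, h⟩ := exists_hasJordanForm (toC (E⁻¹ * A))
  exact ⟨E, A, B, C, hE, ⟨r, μ, d, h, h⟩, rfl⟩

end Realization

/-! ### The ADI basis of a descriptor system -/

section DescriptorADI

variable {n m k : ℕ} {E A : Matrix (Fin n) (Fin n) ℝ} {B : Matrix (Fin n) (Fin m) ℝ}

/-- A finite family of shifts, continued by the shift `1`. -/
noncomputable def extendShifts (σ : Fin k → ℂ) (i : ℕ) : ℂ := if h : i < k then σ ⟨i, h⟩ else 1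

theorem extendShifts_of_lt (σ : Fin k → ℂ) {i : ℕ} (h : i < k) : extendShifts σ i = σ ⟨i, h⟩ :=
  dif_pos h

theorem extendShifts_re_pos {σ : Fin k → ℂ} (hσ : ∀ i, 0 < (σ i).re) (i : ℕ) :
    0 < (extendShifts σ i).re := by
  unfold extendShifts
  split_ifs
  · exact hσ _
  · simp

theorem adiBlock_eq_adiSeq (hE : IsUnit E.det) (hM : IsHurwitz (toC (E⁻¹ * A))) {σ : Fin k → ℂ}
    (hσ : ∀ i, 0 < (σ i).re) (i : ℕ) (h : i < k) :
    adiBlock E A B σ i h = adiSeq (toC (E⁻¹ * A)) (toC (E⁻¹ * B)) (extendShifts σ) i := by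
  induction i with
  | zero =>
    rw [adiBlock, adiSeq, adiResidual, adiWeight, pencil_inv hE, extendShifts_of_lt σ h,
      toC_mul E⁻¹ B, Matrix.mul_assoc]
  | succ i ih =>
    rw [adiBlock, ih (Nat.lt_of_succ_lt h), adiSeq_succ hM (extendShifts_re_pos hσ),
      pencil_inv hE, extendShifts_of_lt σ h, extendShifts_of_lt σ (Nat.lt_of_succ_lt h),
      Matrix.mul_assoc _ (toC E⁻¹), toC_inv_mul_toC hE, Matrix.mul_one]

theorem adiBasis_eq_adiMatrix (hE : IsUnit E.det) (hM : IsHurwitz (toC (E⁻¹ * A))) {σ : Fin k → ℂ}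
    (hσ : ∀ i, 0 < (σ i).re) : adiBasis E A B σ =
      adiMatrix (toC (E⁻¹ * A)) (toC (E⁻¹ * B)) (extendShifts σ) k := by
  ext r c
  simp only [adiBasis, adiMatrix, Matrix.of_apply, adiBlock_eq_adiSeq hE hM hσ]

theorem krylovSubspace_le_range (hE : IsUnit E.det) (hM : IsHurwitz (toC (E⁻¹ * A)))
    {σ : Fin k → ℂ} (hσ : ∀ i, 0 < (σ i).re) : krylovSubspace E A B σ ≤ LinearMap.range
      (adiMatrix (toC (E⁻¹ * A)) (toC (E⁻¹ * B)) (extendShifts σ) k).mulVecLin := by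
  refine Submodule.span_le.2 ?_
  rintro _ ⟨i, j, c, hj, rfl⟩
  have hcard : shiftMult σ (σ i) ≤
      ((Finset.range k).filter (extendShifts σ · = σ i)).card := by
    classical
    rw [shiftMult, Set.ncard_eq_toFinset_card']
    refine Finset.card_le_card_of_injOn Fin.val (fun l hl => ?_) Fin.val_injective.injOn
    have hl' : σ l = σ i := by simpa using hl
    simp [extendShifts_of_lt σ l.2, hl']
  obtain ⟨a, ha⟩ := exists_resolvent_pow_mul_eq_sum_adiSeq (b := toC (E⁻¹ * B)) hM
    (extendShifts_re_pos hσ) (hσ i) (hj.trans_le hcard)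
  refine ⟨fun x => if x.2 = c then a x.1 else 0, ?_⟩
  rw [pencil_inv hE, Matrix.mul_assoc _ (toC E⁻¹), toC_inv_mul_toC hE, Matrix.mul_one,
    Matrix.mul_assoc _ (toC E⁻¹), ← toC_mul, ← Matrix.mul_assoc, ← pow_succ, ha]
  ext r
  simp only [Matrix.mulVecLin_apply, Matrix.mulVec, dotProduct, adiMatrix, Matrix.of_apply,
    Fintype.sum_prod_type, Matrix.col_apply, Matrix.sum_apply, Matrix.smul_apply, smul_eq_mul]
  rw [← Fin.sum_univ_eq_sum_range (fun l => a l *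
    adiSeq (toC (E⁻¹ * A)) (toC (E⁻¹ * B)) (extendShifts σ) l r c) k]
  exact Finset.sum_congr rfl fun l _ => by simp [mul_comm]

/-- If the columns of `V` are linearly independent and lie in the range of `Z`, which has as many
columns, then the columns of `Z` are linearly independent and `V = Z T` with `T` invertible. -/
theorem exists_factorization {ι κ ν : Type*} [Fintype ι] [Fintype κ] [DecidableEq κ] [Fintype ν]
    [DecidableEq ν] {V : Matrix ι ν ℂ} {Z : Matrix ι κ ℂ} (hcard : Fintype.card ν = Fintype.card κ)
    (hV : LinearIndependent ℂ V.col) (hVZ : ∀ j, V.col j ∈ LinearMap.range Z.mulVecLin) :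
    ∃ (T : Matrix κ ν ℂ) (T' : Matrix ν κ ℂ), T * T' = 1 ∧ T' * T = 1 ∧ V = Z * T ∧
      ∀ v, Z *ᵥ v = 0 → v = 0 := by
  choose t ht using hVZ
  let T : Matrix κ ν ℂ := Matrix.of fun i j => t j i
  have hVT : V = Z * T := by
    ext r j
    exact (congrFun (ht j) r).symm
  have hVinj : Function.Injective V.mulVec := Matrix.mulVec_injective_iff.2 hV
  have hTinj : Function.Injective (Matrix.toLin' T) := by
    intro v w hvw
    apply hVinj
    simp only [Matrix.toLin'_apply] at hvw
    rw [hVT, ← Matrix.mulVec_mulVec, ← Matrix.mulVec_mulVec, hvw]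
  let e := LinearEquiv.ofInjectiveOfFinrankEq (Matrix.toLin' T) hTinj (by simp [hcard])
  have he : (e : (ν → ℂ) →ₗ[ℂ] κ → ℂ) = Matrix.toLin' T := by
    ext; simp [e]
  have h1 : T * LinearMap.toMatrix' (e.symm : (κ → ℂ) →ₗ[ℂ] ν → ℂ) = 1 := by
    rw [← LinearMap.toMatrix'_toLin' T, ← he, ← LinearMap.toMatrix'_comp]
    simp
  have h2 : LinearMap.toMatrix' (e.symm : (κ → ℂ) →ₗ[ℂ] ν → ℂ) * T = 1 := by
    rw [← LinearMap.toMatrix'_toLin' T, ← he, ← LinearMap.toMatrix'_comp]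
    simp
  refine ⟨T, _, h1, h2, hVT, fun v hv => ?_⟩
  have h3 : V *ᵥ (LinearMap.toMatrix' (e.symm : (κ → ℂ) →ₗ[ℂ] ν → ℂ) *ᵥ v) = V *ᵥ 0 := by
    rw [Matrix.mulVec_mulVec, hVT, Matrix.mul_assoc, h1, Matrix.mul_one, hv, Matrix.mulVec_zero]
  have h4 := hVinj h3
  rw [← Matrix.one_mulVec v, ← h1, ← Matrix.mulVec_mulVec, h4, Matrix.mulVec_zero]

end DescriptorADI

/-! ### Optimality of the projected system -/

theorem theorem3p3 {n m p k q : ℕ}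
    (E A : Matrix (Fin n) (Fin n) ℝ) (B : Matrix (Fin n) (Fin m) ℝ)
    (hE : IsUnit E.det) (hstable : AsymptoticallyStable E A)
    (σ : Fin k → ℂ) (hσ : ∀ i, 0 < (σ i).re)
    (hconj : ∀ z : ℂ, shiftMult σ ((starRingEnd ℂ) z) = shiftMult σ z)
    (hq : q = k * m)
    (V : Matrix (Fin n) (Fin q) ℝ) (hV : IsRealKrylovBasis E A B σ V)
    (W : Matrix (Fin n) (Fin q) ℝ)
    (A_q E_q P_q : Matrix (Fin q) (Fin q) ℝ) (B_q : Matrix (Fin q) (Fin m) ℝ)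
    (hAq : A_q = Wᵀ * A * V) (hEq : E_q = Wᵀ * E * V) (hBq : B_q = Wᵀ * B)
    (hEq_unit : IsUnit E_q.det)
    (hPq : A_q * P_q * E_qᵀ + E_q * P_q * A_qᵀ + B_q * B_qᵀ = 0)
    (hADI : toC (V * P_q * Vᵀ) = adiBasis E A B σ * (adiBasis E A B σ)ᴴ)
    (C : Matrix (Fin p) (Fin n) ℝ) (C_q : Matrix (Fin p) (Fin q) ℝ) (hCq : C_q = C * V) :
    transferFunction E_q A_q B_q C_q ∈ sameJordanSystems p m E_q A_q ∧
      (∀ H ∈ sameJordanSystems p m E_q A_q,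
        HasFiniteH2Norm (transferFunction E A B C - H)) ∧
      IsLeast ((fun H => h2Norm (transferFunction E A B C - H)) '' sameJordanSystems p m E_q A_q)
        (h2Norm (transferFunction E A B C - transferFunction E_q A_q B_q C_q)) := by
  have hM : IsHurwitz (toC (E⁻¹ * A)) := hstable
  rw [adiBasis_eq_adiMatrix hE hM hσ] at hADI
  have hcol : ∀ j, (toC V).col j ∈ LinearMap.range
      (adiMatrix (toC (E⁻¹ * A)) (toC (E⁻¹ * B)) (extendShifts σ) k).mulVecLin := fun j =>
    krylovSubspace_le_range hE hM hσ (hV.2 ▸ Submodule.subset_span (Set.mem_range_self j))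
  obtain ⟨T, T', hTT', hT'T, hVT, hinj⟩ := exists_factorization (by simp [hq]) hV.1 hcol
  have hLB := isLosslessBasis_adiMatrix hM (extendShifts_re_pos hσ) hinj
  have hcomm := exists_commute_adiS hLB
  set M := toC (E⁻¹ * A) with hMdef
  set b := toC (E⁻¹ * B) with hbdef
  set S := adiS (Fin m) (extendShifts σ) k
  set L := adiL (Fin m) (extendShifts σ) k
  set Z := adiMatrix M b (extendShifts σ) k
  have hEM : toC A = toC E * M := by
    rw [hMdef, toC_mul, ← Matrix.mul_assoc, toC_mul_toC_inv hE, Matrix.one_mul]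
  have hEb : toC B = toC E * b := by
    rw [hbdef, toC_mul, ← Matrix.mul_assoc, toC_mul_toC_inv hE, Matrix.one_mul]
  have hΛ : toC (E_q⁻¹ * A_q) = T' * S * T + toC (E_q⁻¹ * B_q) * (L * T) := by
    have h1 : toC A_q = toC E_q * (T' * S * T) + toC B_q * (L * T) := by
      rw [hAq, hEq, hBq]
      simp only [toC_mul]
      rw [hEM, hEb, hVT]
      calc toC Wᵀ * (toC E * M) * (Z * T) = toC Wᵀ * toC E * (M * Z) * T := by
            simp only [Matrix.mul_assoc]
        _ = toC Wᵀ * toC E * Z * (T * T') * S * T + toC Wᵀ * (toC E * b) * (L * T) := by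
            rw [hLB.sylvester, hTT', Matrix.mul_one]
            simp only [Matrix.mul_add, Matrix.add_mul, Matrix.mul_assoc]
        _ = _ := by simp only [Matrix.mul_assoc]
    rw [toC_mul, h1, Matrix.mul_add, ← Matrix.mul_assoc, toC_inv_mul_toC hEq_unit, Matrix.one_mul,
      toC_mul E_q⁻¹ B_q, Matrix.mul_assoc (toC E_q⁻¹)]
  have hlyap : toC (E_q⁻¹ * A_q) * toC P_q + toC P_q * (toC (E_q⁻¹ * A_q))ᴴ +
      toC (E_q⁻¹ * B_q) * (toC (E_q⁻¹ * B_q))ᴴ = 0 := by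
    have h1 : E_q⁻¹ * A_q * P_q + P_q * (E_q⁻¹ * A_q)ᵀ + E_q⁻¹ * B_q * (E_q⁻¹ * B_q)ᵀ = 0 := by
      have hI := Matrix.nonsing_inv_mul _ hEq_unit
      have hI' : E_qᵀ * E_q⁻¹ᵀ = 1 := by
        rw [← Matrix.transpose_mul, hI, Matrix.transpose_one]
      calc E_q⁻¹ * A_q * P_q + P_q * (E_q⁻¹ * A_q)ᵀ + E_q⁻¹ * B_q * (E_q⁻¹ * B_q)ᵀ
          = E_q⁻¹ * A_q * P_q * (E_qᵀ * E_q⁻¹ᵀ) + (E_q⁻¹ * E_q) * P_q * (E_q⁻¹ * A_q)ᵀ +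
              E_q⁻¹ * B_q * (E_q⁻¹ * B_q)ᵀ := by
            rw [hI, hI', Matrix.mul_one, Matrix.one_mul]
        _ = E_q⁻¹ * (A_q * P_q * E_qᵀ + E_q * P_q * A_qᵀ + B_q * B_qᵀ) * E_q⁻¹ᵀ := by
            simp only [Matrix.transpose_mul, Matrix.mul_add, Matrix.add_mul, Matrix.mul_assoc]
        _ = 0 := by rw [hPq, Matrix.mul_zero, Matrix.zero_mul]
    have h2 := congrArg toC h1
    rwa [toC_add, toC_add, toC_mul _ P_q, toC_mul P_q, toC_mul (E_q⁻¹ * B_q), toC_transpose,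
      toC_transpose, toC_zero] at h2
  have hgram : (Z * T) * toC P_q * (Z * T)ᴴ = Z * Zᴴ := by
    rw [← hVT, ← hADI, toC_mul, toC_mul, toC_transpose]
  obtain ⟨hΛ', hβ'⟩ := hLB.projection_eq hTT' hT'T hΛ hlyap hgram
  have hS := hLB.isHurwitz_neg_conjTranspose
  have hmem := transferFunction_mem_sameJordanSystems (p := p) hEq_unit A_q B_q C_q
  have hGdecay : MatrixHardyDecay (transferFunction E A B C) := by
    rw [transferFunction_eq hE]
    exact fun i j => hM.hardyDecay_mul_resolvent_mul _ _ i j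
  have hHdecay : ∀ H ∈ sameJordanSystems p m E_q A_q, MatrixHardyDecay H := by
    intro H hH
    obtain ⟨c', β, rfl⟩ := exists_realization_of_mem_sameJordanSystems hTT' hT'T hΛ' hH
    exact fun i j => hS.hardyDecay_mul_resolvent_mul _ _ i j
  have herr : transferFunction E A B C - transferFunction E_q A_q B_q C_q = fun z =>
      toC C * (z • 1 - M)⁻¹ * b - toC C * Z * (z • 1 - -Sᴴ)⁻¹ * -Lᴴ := by
    rw [transferFunction_eq hE, transferFunction_eq hEq_unit, hΛ', hβ', hCq, toC_mul C V, hVT]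
    funext z
    rw [Pi.sub_apply, resolvent_similar hT'T hTT']
    congr 1
    calc toC C * (Z * T) * (T' * (z • 1 - -Sᴴ)⁻¹ * T) * (T' * -Lᴴ)
        = toC C * Z * ((T * T') * (z • 1 - -Sᴴ)⁻¹ * (T * T')) * -Lᴴ := by
          simp only [Matrix.mul_assoc]
      _ = _ := by rw [hTT', Matrix.one_mul, Matrix.mul_one]
  have horth : ∀ H ∈ sameJordanSystems p m E_q A_q,
      ∫ ω, h2Pairing (transferFunction E A B C - transferFunction E_q A_q B_q C_q) H ω = 0 := by
    intro H hH
    obtain ⟨c', β, rfl⟩ := exists_realization_of_mem_sameJordanSystems hTT' hT'T hΛ' hH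
    rw [herr]
    exact hLB.integral_h2Pairing_eq_zero hcomm (toC C) c' β
  refine ⟨hmem, fun H hH => (hGdecay.sub (hHdecay H hH)).hasFiniteH2Norm, ⟨_, hmem, rfl⟩, ?_⟩
  rintro _ ⟨H, hH, rfl⟩
  have hF := hGdecay.sub (hHdecay _ hmem)
  have hsplit : transferFunction E A B C - H =
      (transferFunction E A B C - transferFunction E_q A_q B_q C_q) +
        (transferFunction E_q A_q B_q C_q - H) := by abel
  change _ ≤ h2Norm (transferFunction E A B C - H)
  rw [hsplit]
  refine h2Norm_le_h2Norm_add hF ((hHdecay _ hmem).sub (hHdecay H hH)) ?_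
  -- Both systems lie in the class, so their difference is orthogonal to the error although it need
  -- not belong to the class itself.
  have hpt : h2Pairing (transferFunction E A B C - transferFunction E_q A_q B_q C_q)
      (transferFunction E_q A_q B_q C_q - H) = fun ω =>
      h2Pairing (transferFunction E A B C - transferFunction E_q A_q B_q C_q)
        (transferFunction E_q A_q B_q C_q) ω -
      h2Pairing (transferFunction E A B C - transferFunction E_q A_q B_q C_q) H ω := by
    funext ω
    simp only [h2Pairing, Pi.sub_apply _ H, Matrix.conjTranspose_sub, Matrix.mul_sub,
      Matrix.trace_sub]
  rw [hpt, MeasureTheory.integral_sub (h2Pairing_integrable hF (hHdecay _ hmem))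
    (h2Pairing_integrable hF (hHdecay H hH)), horth _ hmem, horth H hH, sub_zero]
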